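/- For an integer $a\neq 0$ let $L_a(s)=\sum_{l>0,\ l\text{ odd}}\left(\frac{-a}{l}\right)l^{-s}$, where $\left(\frac{\cdot}{\cdot}\right)$ is the Jacobi symbol and the series is summed in increasing order of $l$. For $m\ge 1$ put $K_1=\tfrac12$ and $K_m=1$ for $m>1$, and $$c_{m,n}=\frac{(2n)!\,L_m(2n+1)}{K_m\sqrt m}\left(\frac{\pi}{2m}\right)^{-2n-1}\ (n\ge 0),\qquad d_{m,n}=\frac{(2n-1)!\,L_{-m}(2n)}{K_m\sqrt m}\left(\frac{\pi}{2m}\right)^{-2n}\ (n\ge 1).$$ The generalized Euler and class numbers are $s_{m,n}=c_{m,n/2}$ for even $n$ and $s_{m,n}=d_{m,(n+1)/2}$ for odd $n$, with exponential generating function $s_m(x)=\sum_{n\ge 0}s_{m,n}\frac{x^n}{n!}$. For $0\le p\le m$ let $$\Lambda_{m,p}(x)=\frac{\cos((m-p)x)+\sin(px)}{\cos(mx)}.$$ **Theorem.** Let $m>1$ be square-free with $m=4t+1$. Then the series $L_m(2n+1)$ $(n\ge 0)$ and $L_{-m}(2n)$ $(n\ge 1)$ converge, and for all real $x$ with $|x|<\pi/(2m)$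 the series $s_m(x)$ converges and $$s_m(x)=\sum_{k=1}^{t}\left(\frac{k}{m}\right)\Lambda_{m,m-4k}(x)-\sum_{k=t+1}^{2t}\left(\frac{k}{m}\right)\Lambda_{m,4k-m}(x).$$ -/

import Mathlib

open Filter Topology

namespace GenEuler

/-- The sum of the first `N` terms (`l = 1, 3, …, 2N - 1`) of the Dirichlet series
`L_a(s) = ∑_{l > 0, l odd} (-a / l) l^{-s}`, where `(-a / l)` is the Jacobi symbol. -/
noncomputable def dirichletPartial (a : ℤ) (s N : ℕ) : ℝ :=
  ∑ j ∈ Finset.range N, (jacobiSym (-a) (2 * j + 1) : ℝ) / ((2 * j + 1 : ℕ) : ℝ) ^ s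

/-- `L_a(s)` at a natural number `s`, as the limit of the partial sums in the natural order
(the series converges only conditionally at `s = 1`). -/
noncomputable def dirichletL (a : ℤ) (s : ℕ) : ℝ :=
  limUnder atTop (dirichletPartial a s)

/-- The constant `K_m`. -/
noncomputable def K (m : ℕ) : ℝ := if m = 1 then 1 / 2 else 1

/-- `c_{m,n}`, for `n ≥ 0`. -/
noncomputable def c (m n : ℕ) : ℝ :=
  ((2 * n).factorial : ℝ) * dirichletL (m : ℤ) (2 * n + 1) * (K m * √(m : ℝ))⁻¹ *
    ((Real.pi / (2 * (m : ℝ))) ^ (2 * n + 1))⁻¹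

/-- `d_{m,n}`, used for `n ≥ 1` only. -/
noncomputable def d (m n : ℕ) : ℝ :=
  ((2 * n - 1).factorial : ℝ) * dirichletL (-(m : ℤ)) (2 * n) * (K m * √(m : ℝ))⁻¹ *
    ((Real.pi / (2 * (m : ℝ))) ^ (2 * n))⁻¹

/-- The generalized Euler and class numbers `s_{m,n}`. -/
noncomputable def s (m n : ℕ) : ℝ :=
  if Even n then c m (n / 2) else d m ((n + 1) / 2)

/-- The exponential generating function `s_m(x) = ∑_{n ≥ 0} s_{m,n} x^n / n!`. -/
noncomputable def sGen (m : ℕ) (x : ℝ) : ℝ :=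
  ∑' n : ℕ, s m n * x ^ n / (n.factorial : ℝ)

/-- `Λ_{m,p}(x) = (cos ((m - p) x) + sin (p x)) / cos (m x)`. -/
noncomputable def Lam (m p : ℤ) (x : ℝ) : ℝ :=
  (Real.cos (((m : ℝ) - (p : ℝ)) * x) + Real.sin ((p : ℝ) * x)) / Real.cos ((m : ℝ) * x)

end GenEuler

namespace GenEuler

/-! Put y = 2mx/π. Up to the factor 2m/(π√m), s_m(x) is Σ L_m(2n+1) y^(2n) + Σ L_{-m}(2n+2)
y^(2n+1). Summing geometric series over n turns this into Σ (-m/l) l/(l² - y²) + Σ (m/l) y/(l² - y²)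
over odd l > 0. As m ≡ 1 mod 4, reciprocity gives (m/l) = (l/m), and the quadratic Gauss sum of a
squarefree modulus makes √m (l/m) equal to 2 Σ_{k ≤ 2t} (k/m) cos(2πkl/m) (`sqrt_mul_jacobiSym`).
The factor (-1/l) turns each cosine into a signed sine of an angle shifted by π/2. For each k there
remain the partial fractions of cos(y(π/2 - θ)) and sin(y(π/2 - θ)) over cos(πy/2) = cos(mx), given
by `hasSum_odd_sin` and `hasSum_odd_cos`.

Two points need care. L_m(1) is treated as a conditionally convergent series: it is split off and
evaluated by the square wave, `tendsto_sum_sin_odd_div`. The sign of the Gauss sum at a prime comes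
from an estimate: Σ exp(πi n²/(4p)) over odd n modulo 2p is known up to sign, and
`neg_sqrt_lt_re_add_im_sum` rules out one sign. Composite moduli follow by the Chinese remainder
theorem and reciprocity. -/

/-! ### Partial fractions from Fourier series -/

open Complex in
theorem integral_fourier_mul_cos {a : ℝ} {n : ℤ} (h : (a : ℂ) ^ 2 - n ^ 2 ≠ 0) :
    ∫ u in (0 : ℝ)..1, cexp (-(2 * Real.pi * I * n * u)) * cos (2 * Real.pi * a * (u - 1 / 2)) =
      a * sin (Real.pi * a) / (Real.pi * (a ^ 2 - n ^ 2)) := by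
  have hpi : (Real.pi : ℂ) ≠ 0 := by exact_mod_cast Real.pi_ne_zero
  -- An antiderivative, found by solving a 2×2 linear system for the coefficients of cos and sin.
  -- The exponential is 1 at both ends, so only the sine terms survive in F 1 - F 0.
  set F : ℂ → ℂ := fun u => cexp (-(2 * Real.pi * I * n * u)) *
    ((-I * n * cos (2 * Real.pi * a * (u - 1 / 2)) + a * sin (2 * Real.pi * a * (u - 1 / 2))) /
      (2 * Real.pi * (a ^ 2 - n ^ 2))) with hF
  have hd : ∀ u : ℂ, HasDerivAt F (cexp (-(2 * Real.pi * I * n * u)) *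
      cos (2 * Real.pi * a * (u - 1 / 2))) u := by
    intro u
    have h1 : HasDerivAt (fun u : ℂ => -(2 * Real.pi * I * n * u)) (-(2 * Real.pi * I * n)) u := by
      simpa using (hasDerivAt_id u).const_mul (-(2 * Real.pi * I * n))
    have h2 : HasDerivAt (fun u : ℂ => 2 * Real.pi * a * (u - 1 / 2)) (2 * Real.pi * a) u := by
      simpa only [mul_one] using
        ((hasDerivAt_id' u).sub_const (1 / 2)).const_mul (2 * Real.pi * a : ℂ)
    have h3 := h1.cexp.mul
      (((h2.ccos.const_mul (-I * n)).add (h2.csin.const_mul (a : ℂ))).div_const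
        (2 * Real.pi * ((a : ℂ) ^ 2 - n ^ 2)))
    refine h3.congr_deriv ?_
    simp only [Pi.add_apply]
    field_simp
    ring_nf
    simp only [I_sq]
    ring
  have key := intervalIntegral.integral_eq_sub_of_hasDerivAt (a := 0) (b := 1)
    (f := fun u : ℝ => F u) (fun u _ => (hd (u : ℂ)).comp_ofReal)
    (Continuous.intervalIntegrable (by fun_prop) _ _)
  rw [key]
  have e1 : cexp (-(2 * Real.pi * I * n * (1 : ℝ))) = 1 := by
    have := Complex.exp_int_mul_two_pi_mul_I (-n)
    rw [← this]; push_cast; ring_nf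
  have e2 : (2 * Real.pi * a * ((1 : ℝ) - 1 / 2) : ℂ) = Real.pi * a := by push_cast; ring
  have e3 : (2 * Real.pi * a * ((0 : ℝ) - 1 / 2) : ℂ) = -(Real.pi * a) := by push_cast; ring
  simp only [hF, e1, e2, e3, cos_neg, sin_neg]
  simp only [ofReal_zero, mul_zero, neg_zero, exp_zero]
  field_simp
  ring

theorem sq_sub_intCast_sq_ne_zero {a : ℝ} (ha : a ≠ 0) (ha1 : |a| < 1) (n : ℤ) :
    (a : ℝ) ^ 2 - (n : ℝ) ^ 2 ≠ 0 := by
  intro h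
  have h2 : a ^ 2 < 1 := by rw [← sq_abs]; nlinarith [abs_nonneg a]
  have h3 : (n : ℝ) ^ 2 < 1 := by linarith
  have h4 : n ^ 2 < 1 := by exact_mod_cast h3
  have h5 : n = 0 := by
    by_contra h0
    have := sq_pos_of_ne_zero h0
    omega
  subst h5
  simp at h; exact ha h

theorem summable_inv_sq_sub_sq (a : ℝ) (ha1 : |a| < 1) :
    Summable fun n : ℤ => 1 / (a ^ 2 - (n : ℝ) ^ 2) := by
  have h2 : a ^ 2 < 1 := by rw [← sq_abs]; nlinarith [abs_nonneg a]
  have hs := (Real.summable_one_div_int_pow.mpr one_lt_two).mul_left (1 / (1 - a ^ 2))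
  refine hs.of_norm_bounded_eventually ?_
  -- The comparison can fail only at n = 0, where the bound takes the default value 1 / 0 = 0.
  refine (Set.finite_singleton (0 : ℤ)).subset fun n hn => ?_
  by_contra hn0
  apply hn
  have hn1 : (1 : ℝ) ≤ (n : ℝ) ^ 2 := by
    have : (1 : ℤ) ≤ n ^ 2 := by
      have : n ≠ 0 := hn0
      have := sq_pos_of_ne_zero this
      omega
    exact_mod_cast this
  have h5 : (1 - a ^ 2) * (n : ℝ) ^ 2 ≤ (n : ℝ) ^ 2 - a ^ 2 := by nlinarith [sq_nonneg a]
  have h6 : 0 < (1 - a ^ 2) * (n : ℝ) ^ 2 := by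
    apply mul_pos <;> linarith
  rw [Set.mem_ofPred_eq, Real.norm_eq_abs, abs_div, abs_one, abs_sub_comm, abs_of_pos (h6.trans_le h5),
    div_mul_div_comm, one_mul]
  exact one_div_le_one_div_of_le h6 h5

open Complex in
/-- The Fourier expansion of `u ↦ cos (2πa(u - 1/2))` on `[0, 1]`. -/
theorem hasSum_int_cos_fourier {a : ℝ} (ha : a ≠ 0) (ha1 : |a| < 1) {u : ℝ}
    (hu : u ∈ Set.Ico (0 : ℝ) 1) :
    HasSum (fun n : ℤ => (a * sin (Real.pi * a) / (Real.pi * (a ^ 2 - n ^ 2)) : ℂ) *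
      cexp (2 * Real.pi * I * n * u)) (cos (2 * Real.pi * a * (u - 1 / 2))) := by
  have : Fact ((0 : ℝ) < 1) := ⟨one_pos⟩
  set f : ℝ → ℂ := fun u => cos (2 * Real.pi * a * (u - 1 / 2)) with hf
  have hfc : Continuous f := by fun_prop
  -- Equal end values make the periodic extension continuous; with summable coefficients its Fourier
  -- series converges to it pointwise.
  have hends : f 0 = f 1 := by
    simp only [hf]
    rw [← cos_neg]; congr 1; push_cast; ring
  have hcont : Continuous (AddCircle.liftIco (1 : ℝ) 0 f) :=
    AddCircle.liftIco_zero_continuous hends hfc.continuousOn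
  set B : C(AddCircle (1 : ℝ), ℂ) := ⟨AddCircle.liftIco (1 : ℝ) 0 f, hcont⟩ with hB
  have hc : ∀ n : ℤ, fourierCoeff B n =
      (a * sin (Real.pi * a) / (Real.pi * (a ^ 2 - n ^ 2)) : ℂ) := by
    intro n
    have hne : (a : ℂ) ^ 2 - n ^ 2 ≠ 0 := by
      exact_mod_cast sq_sub_intCast_sq_ne_zero ha ha1 n
    rw [hB, ContinuousMap.coe_mk, fourierCoeff_liftIco_eq, fourierCoeffOn_eq_integral,
      ← integral_fourier_mul_cos hne]
    simp only [zero_add, sub_zero, div_one, one_smul, smul_eq_mul]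
    refine intervalIntegral.integral_congr fun x _ => ?_
    simp only [hf]
    rw [fourier_coe_apply]
    congr 2
    push_cast
    ring
  have hsum : Summable (fourierCoeff B) := by
    have h1 := (summable_inv_sq_sub_sq a ha1)
    have h2 : Summable fun n : ℤ => ((1 / (a ^ 2 - (n : ℝ) ^ 2) : ℝ) : ℂ) := by
      exact_mod_cast h1
    refine (h2.mul_left (a * sin (Real.pi * a) / Real.pi)).congr fun n => ?_
    rw [hc]; push_cast; rw [div_mul_div_comm, mul_one]
  have key := has_pointwise_sum_fourier_series_of_summable hsum (u : AddCircle (1 : ℝ))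
  have hval : B (u : AddCircle (1 : ℝ)) = f u := by
    rw [hB, ContinuousMap.coe_mk, AddCircle.liftIco_coe_apply (by simpa using hu)]
  rw [hval] at key
  convert key using 2 with n
  rw [hc, smul_eq_mul, fourier_coe_apply]
  congr 2
  push_cast; ring

/-- Terms n and -n of the Fourier series are paired, so n = 0 is counted twice; this produces the
-1/a. The endpoint 2π is admitted because the expansion is later used at 2θ with θ ≤ π. -/
theorem hasSum_nat_cos {a : ℝ} (ha : a ≠ 0) (ha1 : |a| < 1) {u : ℝ}
    (hu : u ∈ Set.Icc (0 : ℝ) (2 * Real.pi)) :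
    HasSum (fun n : ℕ => 2 * a * Real.cos (n * u) / ((n : ℝ) ^ 2 - a ^ 2))
      (-1 / a - Real.pi * Real.cos (a * (Real.pi - u)) / Real.sin (Real.pi * a)) := by
  have hpi := Real.pi_pos
  have hs : Real.sin (Real.pi * a) ≠ 0 := by
    rw [abs_lt] at ha1
    rcases lt_or_gt_of_ne ha with h | h
    · exact (Real.sin_neg_of_neg_of_neg_pi_lt (by nlinarith) (by nlinarith)).ne
    · exact (Real.sin_pos_of_pos_of_lt_pi (by positivity) (by nlinarith)).ne'
  suffices H : ∀ u ∈ Set.Ico (0 : ℝ) (2 * Real.pi),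
      HasSum (fun n : ℕ => 2 * a * Real.cos (n * u) / ((n : ℝ) ^ 2 - a ^ 2))
      (-1 / a - Real.pi * Real.cos (a * (Real.pi - u)) / Real.sin (Real.pi * a)) by
    rcases hu.2.lt_or_eq with h | h
    · exact H u ⟨hu.1, h⟩
    · have := H 0 ⟨le_rfl, by positivity⟩
      subst h
      convert this using 1
      · ext n
        rw [Real.cos_nat_mul_two_pi]; simp
      · rw [← Real.cos_neg]; congr 4; ring
  intro u hu
  have h1 := (hasSum_int_cos_fourier ha ha1 (u := u / (2 * Real.pi))
    ⟨by have := hu.1; positivity, by rw [div_lt_one (by positivity)]; exact hu.2⟩).nat_add_neg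
  have hexp : ∀ n : ℤ, Complex.exp (2 * Real.pi * Complex.I * n * (u / (2 * Real.pi) : ℝ)) =
      Real.cos (n * u) + Real.sin (n * u) * Complex.I := by
    intro n
    rw [Complex.ofReal_cos, Complex.ofReal_sin, ← Complex.exp_mul_I]
    congr 1
    have : (Real.pi : ℂ) ≠ 0 := by exact_mod_cast hpi.ne'
    push_cast
    field_simp
  have h2 : HasSum (fun n : ℕ => 2 * (a * Real.sin (Real.pi * a) /
      (Real.pi * (a ^ 2 - (n : ℝ) ^ 2))) * Real.cos (n * u))
      (Real.cos (a * (Real.pi - u)) + a * Real.sin (Real.pi * a) / (Real.pi * a ^ 2)) := by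
    rw [← Complex.hasSum_ofReal]
    convert h1 using 1
    · funext n
      rw [hexp, hexp]
      push_cast
      rw [neg_mul, Complex.cos_neg, Complex.sin_neg]
      ring
    · rw [← Complex.cos_neg]
      push_cast
      have : (Real.pi : ℂ) ≠ 0 := by exact_mod_cast hpi.ne'
      simp only [mul_zero, zero_mul, Complex.exp_zero, mul_one]
      congr 2
      · field_simp
        ring
      · ring_nf
  convert! h2.mul_left (-Real.pi / Real.sin (Real.pi * a)) using 1
  · funext n
    have h3 := sq_sub_intCast_sq_ne_zero ha ha1 n
    rw [Int.cast_natCast] at h3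
    have h4 : (n : ℝ) ^ 2 - a ^ 2 ≠ 0 := by rw [← neg_sub]; exact neg_ne_zero.mpr h3
    rw [← neg_sub (a ^ 2)]
    generalize Real.sin (Real.pi * a) = s at hs
    field_simp
  · generalize Real.sin (Real.pi * a) = s at hs
    field_simp
    ring

/-- Partial fractions in `y` of `sin (y(π/2 - θ)) / cos (πy/2)`. -/
theorem hasSum_odd_cos {y : ℝ} (hy : |y| < 1) {θ : ℝ} (hθ : θ ∈ Set.Icc 0 Real.pi) :
    HasSum (fun j : ℕ => y * Real.cos ((2 * j + 1) * θ) / ((2 * j + 1 : ℝ) ^ 2 - y ^ 2))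
      (Real.pi / 4 * (Real.sin (y * (Real.pi / 2 - θ)) / Real.cos (Real.pi * y / 2))) := by
  rcases eq_or_ne y 0 with rfl | hy0
  · simp
  have hpi := Real.pi_pos
  have hy2 : |y / 2| < 1 := by
    rw [abs_div, abs_two]; linarith [abs_nonneg y]
  -- Odd terms are all terms minus the even ones, and the even ones form the same series with y/2
  -- and 2θ.
  have hall := hasSum_nat_cos hy0 hy (u := θ) ⟨hθ.1, by linarith [hθ.2]⟩
  have heven := hasSum_nat_cos (a := y / 2) (by simpa using hy0) hy2 (u := 2 * θ)
    ⟨by linarith [hθ.1], by linarith [hθ.2]⟩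
  set f : ℕ → ℝ := fun n => 2 * y * Real.cos (n * θ) / ((n : ℝ) ^ 2 - y ^ 2) with hf
  have hodd : Summable fun j : ℕ => f (2 * j + 1) :=
    hall.summable.comp_injective fun a b h => by simpa using h
  have heven' : HasSum (fun j : ℕ => f (2 * j))
      ((-1 / (y / 2) - Real.pi * Real.cos (y / 2 * (Real.pi - 2 * θ)) /
        Real.sin (Real.pi * (y / 2))) / 2) := by
    convert! heven.div_const 2 using 1
    funext j
    have h3 := sq_sub_intCast_sq_ne_zero (a := y / 2) (by simpa using hy0) hy2 j
    rw [Int.cast_natCast] at h3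
    have h4 : (j : ℝ) ^ 2 - (y / 2) ^ 2 ≠ 0 := by rw [← neg_sub]; exact neg_ne_zero.mpr h3
    have h5 : ((2 * j : ℕ) : ℝ) ^ 2 - y ^ 2 = 4 * ((j : ℝ) ^ 2 - (y / 2) ^ 2) := by
      push_cast; ring
    simp only [hf, h5]
    rw [show ((2 * j : ℕ) : ℝ) * θ = j * (2 * θ) by push_cast; ring]
    field_simp
    ring
  have hsplit := (heven'.even_add_odd hodd.hasSum).unique hall
  have hval : ∑' j : ℕ, f (2 * j + 1) = Real.pi / 2 *
      (Real.sin (y * (Real.pi / 2 - θ)) / Real.cos (Real.pi * y / 2)) := by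
    have habs := abs_lt.mp hy
    have hc : Real.cos (Real.pi * y / 2) ≠ 0 :=
      (Real.cos_pos_of_mem_Ioo ⟨by nlinarith, by nlinarith⟩).ne'
    have hs : Real.sin (Real.pi * y / 2) ≠ 0 := by
      rcases lt_or_gt_of_ne hy0 with h | h
      · exact (Real.sin_neg_of_neg_of_neg_pi_lt (by nlinarith) (by nlinarith)).ne
      · exact (Real.sin_pos_of_pos_of_lt_pi (by positivity) (by nlinarith)).ne'
    have e1 : Real.sin (Real.pi * y) =
        2 * Real.sin (Real.pi * y / 2) * Real.cos (Real.pi * y / 2) := by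
      rw [← Real.sin_two_mul]; ring_nf
    have e2 : Real.cos (y * (Real.pi - θ)) =
        Real.cos (y * (Real.pi / 2 - θ)) * Real.cos (Real.pi * y / 2) -
        Real.sin (y * (Real.pi / 2 - θ)) * Real.sin (Real.pi * y / 2) := by
      rw [← Real.cos_add]; ring_nf
    have e3 : Real.cos (y / 2 * (Real.pi - 2 * θ)) = Real.cos (y * (Real.pi / 2 - θ)) := by
      ring_nf
    have e4 : Real.sin (Real.pi * (y / 2)) = Real.sin (Real.pi * y / 2) := by ring_nf
    rw [e1, e2, e3, e4] at hsplit
    rw [← sub_eq_iff_eq_add'.mpr hsplit.symm]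
    generalize Real.cos (Real.pi * y / 2) = c at *
    generalize Real.sin (Real.pi * y / 2) = s at *
    field_simp
    ring
  have := (hval ▸ hodd.hasSum).div_const 2
  convert! this using 1
  · funext j
    simp only [hf]
    push_cast
    ring
  · ring

theorem odd_sq_sub_sq_pos {y : ℝ} (hy : |y| < 1) (j : ℕ) : 0 < (2 * j + 1 : ℝ) ^ 2 - y ^ 2 := by
  have h2 : y ^ 2 < 1 := by rw [← sq_abs]; nlinarith [abs_nonneg y]
  have : (0 : ℝ) ≤ j := Nat.cast_nonneg j
  nlinarith

theorem summable_abs_div_odd_sq_sub_sq {y : ℝ} (hy : |y| < 1) :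
    Summable fun j : ℕ => |y| / ((2 * j + 1 : ℝ) ^ 2 - y ^ 2) := by
  have h := hasSum_odd_cos (y := |y|) (by rwa [abs_abs]) (θ := 0) ⟨le_rfl, Real.pi_pos.le⟩
  simpa using h.summable

theorem cos_pi_mul_div_two_pos {y : ℝ} (hy : |y| < 1) : 0 < Real.cos (Real.pi * y / 2) := by
  have hpi := Real.pi_pos
  have habs := abs_lt.mp hy
  exact Real.cos_pos_of_mem_Ioo ⟨by nlinarith, by nlinarith⟩

/-- Partial fractions in `y` of `cos (y(π/2 - θ)) / cos (πy/2)`, with the value at `y = 0` split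
off so that the series converges absolutely. -/
theorem hasSum_odd_sin {y : ℝ} (hy : |y| < 1) {θ : ℝ} (hθ : θ ∈ Set.Icc 0 Real.pi) :
    HasSum (fun j : ℕ => y ^ 2 * Real.sin ((2 * j + 1) * θ) /
        ((2 * j + 1) * ((2 * j + 1 : ℝ) ^ 2 - y ^ 2)))
      (Real.pi / 4 * (Real.cos (y * (Real.pi / 2 - θ)) / Real.cos (Real.pi * y / 2) - 1)) := by
  rcases eq_or_ne y 0 with rfl | hy0
  · simp
  have hc := (cos_pi_mul_div_two_pos hy).ne'
  -- The cosine series is integrated termwise from 0 to θ, dominated by its own values at θ = 0. The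
  -- lower limit contributes the -1.
  have key := intervalIntegral.hasSum_integral_of_dominated_convergence
    (a := 0) (b := θ) (μ := MeasureTheory.volume)
    (F := fun (j : ℕ) φ => y * Real.cos ((2 * j + 1) * φ) / ((2 * j + 1 : ℝ) ^ 2 - y ^ 2))
    (f := fun φ => Real.pi / 4 *
      (Real.sin (y * (Real.pi / 2 - φ)) / Real.cos (Real.pi * y / 2)))
    (fun (j : ℕ) _ => |y| / ((2 * j + 1 : ℝ) ^ 2 - y ^ 2))
    (fun j => (by fun_prop : Continuous _).aestronglyMeasurable)
    (fun j => MeasureTheory.ae_of_all _ fun φ _ => by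
      rw [Real.norm_eq_abs, abs_div, abs_mul, abs_of_pos (odd_sq_sub_sq_pos hy j)]
      gcongr
      · exact (odd_sq_sub_sq_pos hy j).le
      · exact mul_le_of_le_one_right (abs_nonneg y) (Real.abs_cos_le_one _))
    (MeasureTheory.ae_of_all _ fun φ _ => summable_abs_div_odd_sq_sub_sq hy)
    intervalIntegrable_const
    (MeasureTheory.ae_of_all _ fun φ hφ => by
      rw [Set.uIoc_of_le hθ.1] at hφ
      exact hasSum_odd_cos hy ⟨hφ.1.le, hφ.2.trans hθ.2⟩)
  have h2 := key.mul_left y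
  convert! h2 using 1
  · funext j
    have hl : (2 * j + 1 : ℝ) ≠ 0 := by positivity
    have hl2 := (odd_sq_sub_sq_pos hy j).ne'
    have : ∫ φ in (0 : ℝ)..θ, y * Real.cos ((2 * j + 1) * φ) / ((2 * j + 1 : ℝ) ^ 2 - y ^ 2) =
        y * (Real.sin ((2 * j + 1) * θ) / (2 * j + 1)) / ((2 * j + 1 : ℝ) ^ 2 - y ^ 2) := by
      rw [intervalIntegral.integral_div, intervalIntegral.integral_const_mul,
        intervalIntegral.integral_comp_mul_left _ hl, integral_cos]
      simp only [mul_zero, Real.sin_zero, sub_zero, smul_eq_mul]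
      ring
    rw [this]
    field_simp
  · have : ∫ φ in (0 : ℝ)..θ, Real.pi / 4 *
        (Real.sin (y * (Real.pi / 2 - φ)) / Real.cos (Real.pi * y / 2)) =
        Real.pi / 4 * (((Real.cos (y * (Real.pi / 2 - θ)) - Real.cos (Real.pi * y / 2)) / y) /
          Real.cos (Real.pi * y / 2)) := by
      rw [intervalIntegral.integral_const_mul, intervalIntegral.integral_div]
      have hd : ∀ φ ∈ Set.uIcc 0 θ, HasDerivAt (fun φ => Real.cos (y * (Real.pi / 2 - φ)) / y)
          (Real.sin (y * (Real.pi / 2 - φ))) φ := by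
        intro φ _
        have h1 : HasDerivAt (fun φ => y * (Real.pi / 2 - φ)) (y * -1) φ :=
          ((hasDerivAt_id' φ).const_sub (Real.pi / 2)).const_mul y
        refine (h1.cos.div_const y).congr_deriv ?_
        field_simp
      rw [intervalIntegral.integral_eq_sub_of_hasDerivAt hd
        (Continuous.intervalIntegrable (by fun_prop) _ _), sub_zero,
        show y * (Real.pi / 2) = Real.pi * y / 2 by ring, ← sub_div]
    rw [this]
    field_simp

/-! ### The square wave -/

theorem sum_cos_odd_mul_sin (N : ℕ) (φ : ℝ) :
    (∑ j ∈ Finset.range N, Real.cos ((2 * j + 1) * φ)) * (2 * Real.sin φ) =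
      Real.sin (2 * N * φ) := by
  induction N with
  | zero => simp
  | succ n ih =>
    rw [Finset.sum_range_succ, add_mul, ih]
    push_cast
    rw [show (2 * ((n : ℝ) + 1) * φ) = (2 * n + 1) * φ + φ by ring,
      show (2 * (n : ℝ) * φ) = (2 * n + 1) * φ - φ by ring, Real.sin_add, Real.sin_sub]
    ring

open MeasureTheory in
-- Riemann–Lebesgue: the integral is minus the imaginary part of the Fourier transform of
-- `s.indicator g` at frequency N/π.
theorem tendsto_setIntegral_sin {s : Set ℝ} (hs : MeasurableSet s) {g : ℝ → ℝ}
    (hg : IntegrableOn g s) :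
    Tendsto (fun N : ℕ => ∫ φ in s, Real.sin (2 * N * φ) * g φ) atTop (𝓝 0) := by
  have h1 := Real.tendsto_integral_exp_smul_cocompact (fun φ => ((s.indicator g φ : ℝ) : ℂ))
  have h2 : Tendsto (fun N : ℕ => (N : ℝ) / Real.pi) atTop (cocompact ℝ) :=
    (tendsto_natCast_atTop_atTop.atTop_div_const Real.pi_pos).mono_right atTop_le_cocompact
  have h4 := ((Complex.continuous_im.tendsto _).comp (h1.comp h2)).neg
  simp only [Complex.zero_im, neg_zero] at h4
  refine h4.congr fun N => ?_
  have hi : Integrable (fun φ => ((s.indicator g φ : ℝ) : ℂ)) :=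
    ((integrable_indicator_iff hs).mpr hg).ofReal
  have hi2 : Integrable (fun φ : ℝ => Real.fourierChar (-(φ * (N / Real.pi))) •
      ((s.indicator g φ : ℝ) : ℂ)) := by
    refine hi.mono ?_ (Eventually.of_forall fun φ => by rw [Circle.norm_smul])
    refine AEStronglyMeasurable.smul ?_ hi.aestronglyMeasurable
    exact (Continuous.comp (g := ((↑) : Circle → ℂ)) (by fun_prop)
      (by fun_prop : Continuous fun φ : ℝ =>
        Real.fourierChar (-(φ * (N / Real.pi))))).aestronglyMeasurable
  have h5 := Complex.imCLM.integral_comp_comm hi2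
  simp only [Complex.imCLM_apply] at h5
  simp only [Function.comp_apply]
  rw [← h5, ← integral_neg, ← integral_indicator hs]
  refine integral_congr_ae (Eventually.of_forall fun φ => ?_)
  simp only
  rw [Circle.smul_def, Real.fourierChar_apply, smul_eq_mul, Complex.im_mul_ofReal,
    Complex.exp_ofReal_mul_I_im]
  by_cases h : φ ∈ s
  · rw [Set.indicator_of_mem h, Set.indicator_of_mem h]
    rw [show 2 * Real.pi * -(φ * (N / Real.pi)) = -(2 * N * φ) by
      field_simp [Real.pi_ne_zero], Real.sin_neg]
    ring
  · simp [h]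

theorem sin_odd_mul_pi_div_two (j : ℕ) : Real.sin ((2 * j + 1) * (Real.pi / 2)) = (-1) ^ j := by
  rw [show (2 * j + 1) * (Real.pi / 2) = j * Real.pi + Real.pi / 2 by ring, Real.sin_add_pi_div_two,
    Real.cos_nat_mul_pi]

/-- The square wave. -/
theorem tendsto_sum_sin_odd_div {θ : ℝ} (hθ : θ ∈ Set.Ioo 0 Real.pi) :
    Tendsto (fun N : ℕ => ∑ j ∈ Finset.range N, Real.sin ((2 * j + 1) * θ) / (2 * j + 1)) atTop
      (𝓝 (Real.pi / 4)) := by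
  have hpi := Real.pi_pos
  have hsin : ∀ φ ∈ Set.uIcc (Real.pi / 2) θ, Real.sin φ ≠ 0 := by
    intro φ hφ
    have hsub : Set.uIcc (Real.pi / 2) θ ⊆ Set.Ioo 0 Real.pi :=
      Set.OrdConnected.uIcc_subset Set.ordConnected_Ioo ⟨by linarith, by linarith⟩ hθ
    exact (Real.sin_pos_of_mem_Ioo (hsub hφ)).ne'
  have hcont : ContinuousOn (fun φ => (2 * Real.sin φ)⁻¹) (Set.uIcc (Real.pi / 2) θ) :=
    ContinuousOn.inv₀ (by fun_prop) fun φ hφ => mul_ne_zero two_ne_zero (hsin φ hφ)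
  have hrl : Tendsto (fun N : ℕ => ∫ φ in (Real.pi / 2)..θ,
      Real.sin (2 * N * φ) * (2 * Real.sin φ)⁻¹) atTop (𝓝 0) := by
    simp_rw [intervalIntegral.intervalIntegral_eq_integral_uIoc]
    have := (tendsto_setIntegral_sin (measurableSet_uIoc (a := Real.pi / 2) (b := θ))
      (hcont.intervalIntegrable.def')).const_smul
      (if Real.pi / 2 ≤ θ then (1 : ℝ) else -1)
    rwa [smul_zero] at this
  -- At π/2 the sums are those of Leibniz's series; moving from π/2 to θ adds the integral of the
  -- kernel sin(2Nφ)/(2 sin φ), which tends to 0.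
  have hsum := Real.tendsto_sum_pi_div_four.add hrl
  rw [add_zero] at hsum
  refine hsum.congr fun N => ?_
  have hint : ∫ φ in (Real.pi / 2)..θ, Real.sin (2 * N * φ) * (2 * Real.sin φ)⁻¹ =
      ∫ φ in (Real.pi / 2)..θ, ∑ j ∈ Finset.range N, Real.cos ((2 * j + 1) * φ) := by
    refine intervalIntegral.integral_congr fun φ hφ => ?_
    have := mul_ne_zero two_ne_zero (hsin φ hφ)
    rw [← sum_cos_odd_mul_sin, mul_assoc, mul_inv_cancel₀ this, mul_one]
  rw [hint, intervalIntegral.integral_finsetSum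
    fun j _ => Continuous.intervalIntegrable (by fun_prop) _ _, ← Finset.sum_add_distrib]
  refine Finset.sum_congr rfl fun j _ => ?_
  have hl : (2 * j + 1 : ℝ) ≠ 0 := by positivity
  rw [intervalIntegral.integral_comp_mul_left _ hl, integral_cos, sin_odd_mul_pi_div_two,
    smul_eq_mul]
  field_simp
  ring

/-! ### An estimate for a quadratic exponential sum -/

/-- Summation by parts: the variation of decreasing weights telescopes, and with the boundary terms
it amounts to 2 w J. -/
theorem norm_sum_mul_sub_le {w : ℕ → ℝ} {U : ℕ → ℂ} {J M : ℕ} (hw0 : ∀ j < M, 0 ≤ w j)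
    (hw : ∀ j, j + 1 < M → w (j + 1) ≤ w j) (hU : ∀ j, ‖U j‖ ≤ 1) (hJM : J < M) :
    ‖∑ j ∈ Finset.Ico J M, (w j : ℂ) * (U (j + 1) - U j)‖ ≤ 2 * w J := by
  -- Removing the upper boundary term leaves a spare w K in the bound, which absorbs that term at
  -- the end.
  have key : ∀ K, J ≤ K → K < M →
      ‖∑ j ∈ Finset.Ico J (K + 1), (w j : ℂ) * (U (j + 1) - U j) - w K * U (K + 1)‖ ≤
        2 * w J - w K := by
    intro K hJK
    induction K, hJK using Nat.le_induction with
    | base =>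
      intro hM
      rw [Nat.Ico_succ_singleton, Finset.sum_singleton,
        show (w J : ℂ) * (U (J + 1) - U J) - w J * U (J + 1) = -(w J * U J) by ring, norm_neg,
        norm_mul, Complex.norm_real, Real.norm_of_nonneg (hw0 J hM)]
      nlinarith [hU J, hw0 J hM]
    | succ K hJK ih =>
      intro hM
      rw [Finset.sum_Ico_succ_top (by omega)]
      have h1 := ih (by omega)
      have h2 : ‖((w K - w (K + 1) : ℝ) : ℂ) * U (K + 1)‖ ≤ w K - w (K + 1) := by
        have := hw K hM
        rw [norm_mul, Complex.norm_real, Real.norm_of_nonneg (by linarith)]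
        nlinarith [hU (K + 1)]
      refine (le_trans (le_of_eq ?_) (norm_add_le _ _)).trans ((add_le_add h1 h2).trans ?_)
      · congr 1
        push_cast
        ring
      · linarith
  obtain ⟨K, rfl⟩ : ∃ K, M = K + 1 := ⟨M - 1, by omega⟩
  have h1 := key K (by omega) (by omega)
  have h2 : ‖(w K : ℂ) * U (K + 1)‖ ≤ w K := by
    have := hw0 K (by omega)
    rw [norm_mul, Complex.norm_real, Real.norm_of_nonneg this]
    nlinarith [hU (K + 1)]
  calc _ = ‖(∑ j ∈ Finset.Ico J (K + 1), (w j : ℂ) * (U (j + 1) - U j) - w K * U (K + 1)) +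
        w K * U (K + 1)‖ := by rw [sub_add_cancel]
    _ ≤ _ := norm_add_le _ _
    _ ≤ 2 * w J := by linarith

/-- `exp (2πi n² / (8p))`. -/
noncomputable def gaussPhase (p n : ℕ) : ℂ :=
  Complex.exp ((Real.pi * (n : ℝ) ^ 2 / (4 * p) : ℝ) * Complex.I)

theorem norm_gaussPhase (p n : ℕ) : ‖gaussPhase p n‖ = 1 := Complex.norm_exp_ofReal_mul_I _

/-- Since (2j+1)² ± 2(2j+1) = (2j+1 ± 1)² - 1, the two exponentials in the sine move the phase to
the neighbouring even indices. -/
theorem gaussPhase_mul_sin {p : ℕ} (hp : 0 < p) (j : ℕ) :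
    gaussPhase p (2 * j + 1) * (2 * Real.sin (Real.pi * (2 * j + 1) / (2 * p)) : ℝ) =
      (Complex.exp ((-(Real.pi / (4 * p)) : ℝ) * Complex.I) * -Complex.I) *
        (gaussPhase p (2 * (j + 1)) - gaussPhase p (2 * j)) := by
  have hp' : (p : ℂ) ≠ 0 := by exact_mod_cast hp.ne'
  set z := Complex.exp ((-(Real.pi / (4 * p)) : ℝ) * Complex.I) with hz
  set x : ℂ := ((Real.pi * (2 * j + 1) / (2 * p) : ℝ) : ℂ) with hx
  have h1 : gaussPhase p (2 * j + 1) * Complex.exp (-x * Complex.I) =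
      z * gaussPhase p (2 * j) := by
    rw [gaussPhase, gaussPhase, hz, hx, ← Complex.exp_add, ← Complex.exp_add]
    congr 1
    push_cast
    field_simp
    ring
  have h2 : gaussPhase p (2 * j + 1) * Complex.exp (x * Complex.I) =
      z * gaussPhase p (2 * (j + 1)) := by
    rw [gaussPhase, gaussPhase, hz, hx, ← Complex.exp_add, ← Complex.exp_add]
    congr 1
    push_cast
    field_simp
    ring
  rw [Complex.ofReal_mul, Complex.ofReal_sin, Complex.sin, Complex.ofReal_ofNat]
  linear_combination Complex.I * h1 - Complex.I * h2

/-- The bound on M keeps the angles in (0, π/2], where sine increases; the weights 1/(2 sin) then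
decrease and summation by parts applies. Jordan's inequality sin x ≥ 2x/π bounds the first weight.
-/
theorem norm_tail_le {p J M : ℕ} (hM : 2 * M ≤ p + 1) (hJM : J < M) :
    ‖∑ j ∈ Finset.Ico J M, gaussPhase p (2 * j + 1)‖ ≤ p / (2 * J + 1) := by
  have hp : 0 < p := by omega
  have hp' : (0 : ℝ) < p := by exact_mod_cast hp
  have hpi := Real.pi_pos
  set x : ℕ → ℝ := fun j => Real.pi * (2 * j + 1) / (2 * p) with hx
  have hx0 : ∀ j, 0 < x j := fun j => by positivity
  have hx1 : ∀ j < M, x j ≤ Real.pi / 2 := by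
    intro j hj
    have : (2 * j + 1 : ℝ) ≤ p := by exact_mod_cast (by omega : 2 * j + 1 ≤ p)
    simp only [hx]
    rw [div_le_div_iff₀ (by positivity) two_pos]
    nlinarith
  have hs : ∀ j < M, 0 < Real.sin (x j) := fun j hj =>
    Real.sin_pos_of_pos_of_lt_pi (hx0 j) (by linarith [hx1 j hj])
  set w : ℕ → ℝ := fun j => (2 * Real.sin (x j))⁻¹ with hw
  set U : ℕ → ℂ := fun j => (Complex.exp ((-(Real.pi / (4 * p)) : ℝ) * Complex.I) * -Complex.I) *
    gaussPhase p (2 * j) with hU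
  have hterm : ∀ j ∈ Finset.Ico J M,
      gaussPhase p (2 * j + 1) = (w j : ℂ) * (U (j + 1) - U j) := by
    intro j hj
    have h0 : ((2 * Real.sin (x j) : ℝ) : ℂ) ≠ 0 := by
      exact_mod_cast (mul_pos two_pos (hs j (Finset.mem_Ico.mp hj).2)).ne'
    simp only [hU, hw]
    rw [← mul_sub, ← gaussPhase_mul_sin hp j, Complex.ofReal_inv, mul_comm (gaussPhase _ _),
      inv_mul_cancel_left₀ h0]
  rw [Finset.sum_congr rfl hterm]
  refine (norm_sum_mul_sub_le ?_ ?_ ?_ hJM).trans ?_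
  · intro j hj
    have := hs j hj
    positivity
  · intro j hj
    have h1 := hs j (by omega)
    have h2 : Real.sin (x j) ≤ Real.sin (x (j + 1)) := by
      refine Real.sin_le_sin_of_le_of_le_pi_div_two (by linarith [hx0 j]) (hx1 _ hj) ?_
      simp only [hx]
      gcongr
      simp
    simp only [hw]
    gcongr
  · intro j
    simp only [hU]
    rw [norm_mul, norm_mul, norm_gaussPhase, Complex.norm_exp_ofReal_mul_I]
    simp
  · have h1 : 2 / Real.pi * x J ≤ Real.sin (x J) := Real.mul_le_sin (hx0 J).le (hx1 J hJM)
    have h2 : 2 / Real.pi * x J = (2 * J + 1) / p := by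
      simp only [hx]; field_simp
    rw [h2] at h1
    have h3 : (0 : ℝ) < (2 * J + 1) / p := by positivity
    calc 2 * w J = (Real.sin (x J))⁻¹ := by simp only [hw]; rw [mul_inv]; ring
      _ ≤ ((2 * J + 1) / p : ℝ)⁻¹ := by gcongr
      _ = p / (2 * J + 1) := by rw [inv_div]

theorem one_le_re_add_im_gaussPhase {p n : ℕ} (hp : 0 < p) (hn : n ^ 2 ≤ 2 * p) :
    1 ≤ (gaussPhase p n).re + (gaussPhase p n).im := by
  have hp' : (0 : ℝ) < p := by exact_mod_cast hp
  have hpi := Real.pi_pos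
  have hn' : (n : ℝ) ^ 2 ≤ 2 * p := by exact_mod_cast hn
  rw [gaussPhase, Complex.exp_ofReal_mul_I_re, Complex.exp_ofReal_mul_I_im]
  set x := Real.pi * (n : ℝ) ^ 2 / (4 * p)
  have h0 : 0 ≤ x := by positivity
  have h1 : x ≤ Real.pi / 2 := by
    simp only [x]
    rw [div_le_div_iff₀ (by positivity) two_pos]
    nlinarith
  have hc : 0 ≤ Real.cos x := Real.cos_nonneg_of_neg_pi_div_two_le_of_le (by linarith) h1
  have hs : 0 ≤ Real.sin x := Real.sin_nonneg_of_nonneg_of_le_pi h0 (by linarith)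
  nlinarith [Real.sin_sq_add_cos_sq x, mul_nonneg hc hs]

theorem neg_sqrt_two_mul_norm_le (z : ℂ) : -(√2 * ‖z‖) ≤ z.re + z.im := by
  have h2 : √2 ^ 2 = 2 := Real.sq_sqrt two_pos.le
  have h : |z.re + z.im| ≤ √2 * ‖z‖ := by
    refine abs_le_of_sq_le_sq ?_ (by positivity)
    rw [mul_pow, h2, Complex.sq_norm, Complex.normSq_apply]
    nlinarith [sq_nonneg (z.re - z.im)]
  exact (abs_le.mp h).1

/-- Let r = √(2p) and cut at the first J with r < 2J + 1. Each head term contributes at least 1,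
together at least J > (r - 1)/2; the tail has norm at most p/(2J + 1) ≤ r/2 and costs at most √2
r/2. -/
theorem re_add_im_sum_gaussPhase {p M : ℕ} (hp : 0 < p) (hM : 2 * M ≤ p + 1) :
    -((√2 - 1) / 2 * √(2 * p)) - 1 / 2 ≤
      (∑ j ∈ Finset.range M, gaussPhase p (2 * j + 1)).re +
      (∑ j ∈ Finset.range M, gaussPhase p (2 * j + 1)).im := by
  have hp' : (0 : ℝ) < p := by exact_mod_cast hp
  have hex : ∃ J, 2 * p < (2 * J + 1) ^ 2 := ⟨p, by nlinarith⟩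
  classical
  set J := Nat.find hex with hJ
  have hJ1 : 2 * p < (2 * J + 1) ^ 2 := Nat.find_spec hex
  have hJ2 : ∀ j < J, (2 * j + 1) ^ 2 ≤ 2 * p := fun j hj => not_lt.mp (Nat.find_min hex hj)
  have hhead : ∀ L ≤ J, (L : ℝ) ≤
      (∑ j ∈ Finset.range L, gaussPhase p (2 * j + 1)).re +
      (∑ j ∈ Finset.range L, gaussPhase p (2 * j + 1)).im := by
    intro L hL
    rw [Complex.re_sum, Complex.im_sum, ← Finset.sum_add_distrib]
    calc (L : ℝ) = ∑ j ∈ Finset.range L, (1 : ℝ) := by simp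
      _ ≤ _ := Finset.sum_le_sum fun j hj =>
        one_le_re_add_im_gaussPhase hp (hJ2 j ((Finset.mem_range.mp hj).trans_le hL))
  have hs2 : 1 ≤ √2 := by rw [Real.one_le_sqrt]; norm_num
  set r := √(2 * p : ℝ) with hr
  have hr0 : 0 < r := Real.sqrt_pos.mpr (by positivity)
  rcases le_or_gt M J with h | h
  · have := hhead M h
    have h0 : (0 : ℝ) ≤ M := Nat.cast_nonneg M
    have : 0 ≤ (√2 - 1) / 2 * r := by
      apply mul_nonneg _ hr0.le
      linarith
    linarith
  · rw [← Finset.sum_range_add_sum_Ico _ h.le, Complex.add_re, Complex.add_im]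
    have h1 := hhead J le_rfl
    have h2 := neg_sqrt_two_mul_norm_le (∑ j ∈ Finset.Ico J M, gaussPhase p (2 * j + 1))
    have h3 := norm_tail_le hM h
    have h4 : r < 2 * J + 1 := by
      rw [hr, Real.sqrt_lt' (by positivity)]
      exact_mod_cast hJ1
    have h5 : (p : ℝ) / (2 * J + 1) ≤ r / 2 := by
      rw [div_le_div_iff₀ (by positivity) two_pos]
      have : r * r = 2 * p := Real.mul_self_sqrt (by positivity)
      nlinarith
    have h6 : √2 * ‖∑ j ∈ Finset.Ico J M, gaussPhase p (2 * j + 1)‖ ≤ √2 * (r / 2) := by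
      gcongr
      exact h3.trans h5
    linarith

/-- With n = 2j + 1, (2p - n)² - n² = 4p(p - n), and p - n is even. -/
theorem gaussPhase_reflect {p j : ℕ} (hp : Odd p) (hj : j < p) :
    gaussPhase p (2 * (p - 1 - j) + 1) = gaussPhase p (2 * j + 1) := by
  obtain ⟨h, rfl⟩ := hp
  obtain ⟨k, hk⟩ : ∃ k, k + j = 2 * h := ⟨2 * h - j, by omega⟩
  rw [show 2 * h + 1 - 1 - j = k by omega, gaussPhase, gaussPhase,
    Complex.exp_eq_exp_iff_exists_int]
  refine ⟨(h : ℤ) - j, ?_⟩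
  have hc : (k : ℂ) = 2 * h - j := by
    rw [eq_sub_iff_add_eq]; exact_mod_cast hk
  have hp' : ((2 * h + 1 : ℕ) : ℂ) ≠ 0 := by exact_mod_cast (by omega : 2 * h + 1 ≠ 0)
  push_cast [hc] at hp' ⊢
  field_simp
  ring

/-- The quadratic sum `∑ exp (2πi n² / (8p))` over the odd residues `n` modulo `2p` avoids the
half plane that contains `-exp (πi/4) √p`. -/
theorem neg_sqrt_lt_re_add_im_sum {p : ℕ} (hp : Odd p) (hp1 : 1 < p) :
    -√(2 * p) < (∑ j ∈ Finset.range p, gaussPhase p (2 * j + 1)).re +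
      (∑ j ∈ Finset.range p, gaussPhase p (2 * j + 1)).im := by
  obtain ⟨h, rfl⟩ := hp
  -- The reflection n ↦ 2p - n folds the sum onto odd n ≤ p and odd n < p; n = p is its own mirror
  -- image.
  have hsplit : ∑ j ∈ Finset.range (2 * h + 1), gaussPhase (2 * h + 1) (2 * j + 1) =
      ∑ j ∈ Finset.range (h + 1), gaussPhase (2 * h + 1) (2 * j + 1) +
      ∑ j ∈ Finset.range h, gaussPhase (2 * h + 1) (2 * j + 1) := by
    rw [show 2 * h + 1 = (h + 1) + h by ring, Finset.sum_range_add]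
    congr 1
    rw [← Finset.sum_range_reflect]
    refine Finset.sum_congr rfl fun j hj => ?_
    have hj := Finset.mem_range.mp hj
    rw [← gaussPhase_reflect (j := j) ⟨h, by ring⟩ (by omega)]
    congr 2
    omega
  rw [hsplit, Complex.add_re, Complex.add_im]
  have h1 := re_add_im_sum_gaussPhase (p := 2 * h + 1) (M := h + 1) (by omega) (by omega)
  have h2 := re_add_im_sum_gaussPhase (p := 2 * h + 1) (M := h) (by omega) (by omega)
  set r := √(2 * (2 * h + 1 : ℕ) : ℝ) with hr
  have hr2 : 2 < r := by
    rw [hr, Real.lt_sqrt two_pos.le]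
    have : (1 : ℝ) ≤ h := by exact_mod_cast (by omega : 1 ≤ h)
    push_cast
    linarith
  have hs2 : √2 < 3 / 2 := by
    rw [Real.sqrt_lt' (by norm_num)]; norm_num
  -- The halves add up to at least -(√2 - 1) r - 1, which exceeds -r because (2 - √2) r > 1.
  nlinarith

/-! ### The Gauss sum of a prime, with its sign -/

theorem sum_range_natCast_zmod {m : ℕ} [NeZero m] {E : Type*} [AddCommMonoid E] (f : ZMod m → E) :
    ∑ k ∈ Finset.range m, f (k : ZMod m) = ∑ x, f x :=
  Finset.sum_nbij' (fun k => (k : ZMod m)) ZMod.val (fun _ _ => Finset.mem_univ _)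
    (fun x _ => Finset.mem_range.mpr (ZMod.val_lt x))
    (fun _ hk => ZMod.val_natCast_of_lt (Finset.mem_range.mp hk))
    (fun x _ => ZMod.natCast_zmod_val x) (fun _ _ => rfl)

/-- The quadratic character of `ZMod p` with complex values. -/
noncomputable def quadChar (p : ℕ) [Fact p.Prime] : MulChar (ZMod p) ℂ :=
  (quadraticChar (ZMod p)).ringHomComp (Int.castRingHom ℂ)

theorem quadChar_apply {p : ℕ} [Fact p.Prime] (x : ZMod p) :
    quadChar p x = (quadraticChar (ZMod p) x : ℂ) := rfl

theorem quadChar_intCast {p : ℕ} [Fact p.Prime] (k : ℤ) :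
    quadChar p (k : ZMod p) = (jacobiSym k p : ℂ) := by
  rw [quadChar_apply, ← jacobiSym.legendreSym.to_jacobiSym]; rfl

theorem quadChar_ne_one {p : ℕ} [Fact p.Prime] (hp : p ≠ 2) : quadChar p ≠ 1 := by
  rw [quadChar, MulChar.ringHomComp_ne_one_iff (RingHom.injective_int _)]
  exact quadraticChar_ne_one (by rwa [ZMod.ringChar_zmod_n])

theorem quadChar_isQuadratic (p : ℕ) [Fact p.Prime] : (quadChar p).IsQuadratic :=
  (quadraticChar_isQuadratic _).comp _

theorem quadChar_mul_self {p : ℕ} [Fact p.Prime] {b : ZMod p} (hb : b ≠ 0) :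
    quadChar p b * quadChar p b = 1 := by
  rw [quadChar_apply, ← Int.cast_mul, ← sq, quadraticChar_sq_one hb, Int.cast_one]

/-- Each y has 1 + χ(y) square roots; the 1 contributes a full character sum, which vanishes, and
the shift by b pulls out χ(b). -/
theorem sum_stdAddChar_mul_sq {p : ℕ} [Fact p.Prime] (hp : p ≠ 2) {b : ZMod p} (hb : b ≠ 0) :
    ∑ x : ZMod p, ZMod.stdAddChar (b * x ^ 2) =
      quadChar p b * gaussSum (quadChar p) ZMod.stdAddChar := by
  have h1 : gaussSum (quadChar p) (ZMod.stdAddChar.mulShift b) =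
      quadChar p b * gaussSum (quadChar p) ZMod.stdAddChar := by
    have := gaussSum_mulShift (quadChar p) ZMod.stdAddChar (Units.mk0 b hb)
    rw [Units.val_mk0] at this
    rw [← this, ← mul_assoc, quadChar_mul_self hb, one_mul]
  have h2 : ∑ y : ZMod p, (ZMod.stdAddChar (b * y) : ℂ) = 0 := by
    have := AddChar.sum_mulShift b (ZMod.isPrimitive_stdAddChar p)
    rw [if_neg hb] at this
    simpa [mul_comm] using this
  rw [← h1, gaussSum, ← Finset.sum_fiberwise Finset.univ (fun x : ZMod p => x ^ 2)]
  have h3 : ∀ y : ZMod p, ∑ x with x ^ 2 = y, (ZMod.stdAddChar (b * x ^ 2) : ℂ) =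
      quadChar p y * ZMod.stdAddChar (b * y) + ZMod.stdAddChar (b * y) := by
    intro y
    rw [Finset.sum_congr rfl (g := fun _ => (ZMod.stdAddChar (b * y) : ℂ))
      fun x hx => by rw [(Finset.mem_filter.mp hx).2]]
    have hcard := quadraticChar_card_sqrts (F := ZMod p) (by rwa [ZMod.ringChar_zmod_n]) y
    have h4 : {x : ZMod p | x ^ 2 = y}.toFinset = Finset.univ.filter fun x => x ^ 2 = y := by
      ext x; simp
    rw [h4] at hcard
    have h5 : ((Finset.univ.filter fun x : ZMod p => x ^ 2 = y).card : ℂ) = quadChar p y + 1 := by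
      rw [quadChar_apply]; exact_mod_cast congrArg (Int.cast : ℤ → ℂ) hcard
    rw [Finset.sum_const, nsmul_eq_mul, h5]
    ring
  rw [Finset.sum_congr rfl fun y _ => h3 y, Finset.sum_add_distrib, h2, add_zero]
  rfl

/-- B is an inverse of 8 modulo p. As n = 2j + 1 has n² ≡ 1 mod 8, the fractions n²/(8p) and Bn²/p
differ by p/8 modulo 1. -/
theorem gaussPhase_eq {p : ℕ} [NeZero p] {B : ℤ} (hB : 8 * B = 1 - (p : ℤ) ^ 2) (j : ℕ) :
    gaussPhase p (2 * j + 1) = Complex.exp (Real.pi * p / 4 * Complex.I) *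
      ZMod.stdAddChar ((B : ZMod p) * (2 * (j : ZMod p) + 1) ^ 2) := by
  have hp : (p : ℂ) ≠ 0 := by exact_mod_cast NeZero.ne p
  have hB' : (B : ℂ) = (1 - (p : ℂ) ^ 2) / 8 := by
    rw [eq_div_iff (by norm_num)]
    have := congrArg (Int.cast : ℤ → ℂ) hB
    push_cast at this
    linear_combination this
  obtain ⟨c, hc⟩ := Nat.even_mul_succ_self j
  have hc' : (j : ℂ) * (j + 1) = c + c := by exact_mod_cast hc
  have h1 : ((B : ZMod p) * (2 * (j : ZMod p) + 1) ^ 2) = ((B * (2 * j + 1) ^ 2 : ℤ) : ZMod p) := by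
    push_cast; ring
  rw [h1, ZMod.stdAddChar_coe, gaussPhase, ← Complex.exp_add, Complex.exp_eq_exp_iff_exists_int]
  refine ⟨p * c, ?_⟩
  push_cast
  rw [hB', show (c : ℂ) = j * (j + 1) / 2 by rw [hc']; ring]
  field_simp
  ring

theorem eight_mul_intCast {p : ℕ} {B : ℤ} (hB : 8 * B = 1 - (p : ℤ) ^ 2) :
    (8 : ZMod p) * B = 1 := by
  have := congrArg (Int.cast : ℤ → ZMod p) hB
  push_cast at this
  simpa using this

theorem sum_gaussPhase {p : ℕ} [Fact p.Prime] (hp : p ≠ 2) {B : ℤ}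
    (hB : 8 * B = 1 - (p : ℤ) ^ 2) :
    ∑ j ∈ Finset.range p, gaussPhase p (2 * j + 1) = Complex.exp (Real.pi * p / 4 * Complex.I) *
      (quadChar p B * gaussSum (quadChar p) ZMod.stdAddChar) := by
  have hB0 : (B : ZMod p) ≠ 0 := right_ne_zero_of_mul_eq_one (eight_mul_intCast hB)
  have h2 : (2 : ZMod p) ≠ 0 := by
    intro h
    have : ((2 : ℕ) : ZMod p) = 0 := by exact_mod_cast h
    rw [ZMod.natCast_eq_zero_iff] at this
    exact hp ((Nat.prime_dvd_prime_iff_eq Fact.out Nat.prime_two).mp this)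
  rw [Finset.sum_congr rfl fun j _ => gaussPhase_eq hB j, ← Finset.mul_sum,
    sum_range_natCast_zmod fun x : ZMod p => (ZMod.stdAddChar ((B : ZMod p) * (2 * x + 1) ^ 2) : ℂ),
    ← sum_stdAddChar_mul_sq hp hB0]
  congr 1
  have hbij : Function.Bijective fun x : ZMod p => 2 * x + 1 := by
    rw [← Finite.injective_iff_bijective]
    intro x y hxy
    exact mul_left_cancel₀ h2 (add_right_cancel hxy)
  exact hbij.sum_comp fun x : ZMod p => (ZMod.stdAddChar ((B : ZMod p) * x ^ 2) : ℂ)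

theorem exp_pi_div_four_mul_I :
    Complex.exp (Real.pi / 4 * Complex.I) = (√2 / 2 : ℝ) + (√2 / 2 : ℝ) * Complex.I := by
  have hc := Real.cos_pi_div_four
  have hs := Real.sin_pi_div_four
  rw [Complex.exp_mul_I]
  nth_rw 1 [← hc]
  rw [← hs]
  push_cast
  rfl

theorem exists_eight_mul_eq {p : ℕ} (hp : Odd p) : ∃ B : ℤ, 8 * B = 1 - (p : ℤ) ^ 2 := by
  obtain ⟨h, rfl⟩ := hp
  obtain ⟨c, hc⟩ := Nat.even_mul_succ_self h
  have hc' : (h : ℤ) * (h + 1) = c + c := by exact_mod_cast hc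
  exact ⟨-c, by push_cast; linear_combination 4 * hc'⟩

/-- `gaussSum_sq` determines the square. The wrong sign would make real plus imaginary part equal to
-√(2p), which the half-plane estimate excludes. -/
theorem sum_gaussPhase_eq {p : ℕ} [Fact p.Prime] (hp : p ≠ 2) :
    ∑ j ∈ Finset.range p, gaussPhase p (2 * j + 1) = Complex.exp (Real.pi / 4 * Complex.I) * √p := by
  have hodd : Odd p := Nat.Prime.odd_of_ne_two Fact.out hp
  obtain ⟨B, hB⟩ := exists_eight_mul_eq hodd
  have hre := neg_sqrt_lt_re_add_im_sum hodd (Nat.Prime.one_lt Fact.out)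
  have hpp : ((√p : ℝ) : ℂ) ^ 2 = p := by
    rw [← Complex.ofReal_pow, Real.sq_sqrt (Nat.cast_nonneg p), Complex.ofReal_natCast]
  have hB0 : (B : ZMod p) ≠ 0 := right_ne_zero_of_mul_eq_one (eight_mul_intCast hB)
  have hsq : (∑ j ∈ Finset.range p, gaussPhase p (2 * j + 1)) ^ 2 =
      (Complex.exp (Real.pi / 4 * Complex.I) * √p) ^ 2 := by
    -- The sign χ(-1) = χ₄(p) of the squared Gauss sum cancels against exp(πip/2).
    have h4 : (Complex.exp (Real.pi * p / 4 * Complex.I)) ^ 2 * (ZMod.χ₄ p : ℂ) =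
        (Complex.exp (Real.pi / 4 * Complex.I)) ^ 2 := by
      rw [← Complex.exp_nat_mul, ← Complex.exp_nat_mul]
      rcases Nat.odd_mod_four_iff.mp (Nat.odd_iff.mp hodd) with h | h
      · rw [ZMod.χ₄_nat_one_mod_four h, Int.cast_one, mul_one, Complex.exp_eq_exp_iff_exists_int]
        refine ⟨p / 4, ?_⟩
        have : (p : ℂ) = 4 * (p / 4 : ℕ) + 1 := by exact_mod_cast (by omega : p = 4 * (p / 4) + 1)
        have h' : (((p : ℤ) / 4 : ℤ) : ℂ) = ((p / 4 : ℕ) : ℂ) := by norm_cast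
        rw [h', this]
        push_cast
        ring
      · rw [ZMod.χ₄_nat_three_mod_four h, Int.cast_neg, Int.cast_one, mul_neg_one,
          ← neg_one_mul, ← Complex.exp_pi_mul_I, ← Complex.exp_add,
          Complex.exp_eq_exp_iff_exists_int]
        refine ⟨p / 4 + 1, ?_⟩
        have : (p : ℂ) = 4 * (p / 4 : ℕ) + 3 := by exact_mod_cast (by omega : p = 4 * (p / 4) + 3)
        have h' : (((p : ℤ) / 4 + 1 : ℤ) : ℂ) = ((p / 4 : ℕ) : ℂ) + 1 := by norm_cast
        rw [h', this]
        push_cast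
        ring
    have hgs := gaussSum_sq (χ := quadChar p) (quadChar_ne_one hp)
      (quadChar_isQuadratic p)
      (ZMod.isPrimitive_stdAddChar p)
    rw [sum_gaussPhase hp hB, mul_pow, mul_pow, mul_pow,
      hgs,
      hpp, ZMod.card, sq (quadChar p B), quadChar_mul_self hB0, quadChar_apply,
      quadraticChar_neg_one (by rwa [ZMod.ringChar_zmod_n]), ZMod.card, ← h4]
    ring
  rcases sq_eq_sq_iff_eq_or_eq_neg.mp hsq with h | h
  · exact h
  · exfalso
    rw [h, exp_pi_div_four_mul_I] at hre
    have : √(2 * (p : ℝ)) = √2 * √p := Real.sqrt_mul two_pos.le _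
    rw [this] at hre
    simp at hre
    linarith

/-- The value of the quadratic Gauss sum attached to the Jacobi symbol modulo `m`. -/
noncomputable def gaussValue (m : ℕ) : ℂ := if m % 4 = 1 then (√m : ℝ) else Complex.I * (√m : ℝ)

/-- The character at B = 8⁻¹ equals its value at 2, which is χ₈(p). Dividing the known sum by χ₈(p)
exp(πip/4) leaves √p times 1 or I, according to p mod 8. -/
theorem gaussSum_quadChar {p : ℕ} [Fact p.Prime] (hp : p ≠ 2) :
    gaussSum (quadChar p) ZMod.stdAddChar = gaussValue p := by
  have hodd : Odd p := Nat.Prime.odd_of_ne_two Fact.out hp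
  obtain ⟨B, hB⟩ := exists_eight_mul_eq hodd
  have hB1 := eight_mul_intCast hB
  have h2 : (2 : ZMod p) ≠ 0 := by
    rintro h
    rw [show (8 : ZMod p) = 2 * 4 by norm_num, h] at hB1
    simp at hB1
  have hχB : quadChar p B = (ZMod.χ₈ p : ℂ) := by
    have h8 : quadChar p 8 = quadChar p 2 := by
      rw [show (8 : ZMod p) = 2 * 2 * 2 by norm_num, map_mul, map_mul, quadChar_mul_self h2,
        one_mul]
    have h3 : quadChar p 2 * quadChar p B = 1 := by rw [← h8, ← map_mul, hB1, map_one]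
    have h4 : quadChar p B = quadChar p 2 := by
      rw [← one_mul (quadChar p B), ← quadChar_mul_self h2, mul_assoc, h3, mul_one]
    rw [h4, quadChar_apply, quadraticChar_two (by rwa [ZMod.ringChar_zmod_n]), ZMod.card]
  have hsum := (sum_gaussPhase hp hB).symm.trans (sum_gaussPhase_eq hp)
  rw [hχB] at hsum
  have hval : ∀ z : ℂ, z * Complex.exp (Real.pi * p / 4 * Complex.I) * (ZMod.χ₈ p : ℂ) =
      Complex.exp (Real.pi / 4 * Complex.I) →
      (ZMod.χ₈ p : ℂ) ≠ 0 → gaussSum (quadChar p) ZMod.stdAddChar = z * √p := by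
    intro z hz h0
    have h1 := Complex.exp_ne_zero (Real.pi * p / 4 * Complex.I)
    rw [← hz] at hsum
    refine mul_left_cancel₀ (mul_ne_zero h1 h0) ?_
    linear_combination hsum
  have hmod : p % 8 = 1 ∨ p % 8 = 3 ∨ p % 8 = 5 ∨ p % 8 = 7 := by
    have := Nat.odd_iff.mp hodd; omega
  have hper : ∀ r : ℕ, p % 8 = r → Complex.exp (Real.pi * p / 4 * Complex.I) =
      Complex.exp (Real.pi * r / 4 * Complex.I) := by
    intro r hr
    rw [Complex.exp_eq_exp_iff_exists_int]
    obtain ⟨q, hq⟩ : ∃ q, p = 8 * q + r := ⟨p / 8, by omega⟩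
    refine ⟨q, ?_⟩
    rw [hq]
    push_cast
    ring
  have hc : (Complex.exp (Real.pi / 4 * Complex.I)) ^ 2 = Complex.I := by
    rw [← Complex.exp_nat_mul]
    refine Eq.trans ?_ Complex.exp_pi_div_two_mul_I
    push_cast
    ring_nf
  have hpow : ∀ r : ℕ, Complex.exp (Real.pi * r / 4 * Complex.I) =
      Complex.exp (Real.pi / 4 * Complex.I) ^ r := by
    intro r
    rw [← Complex.exp_nat_mul]
    ring_nf
  have hI := Complex.I_sq
  have h8 := ZMod.χ₈_nat_eq_if_mod_eight p
  have hne : (ZMod.χ₈ p : ℂ) ≠ 0 := by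
    rcases hmod with h | h | h | h <;> simp [h8, h, show p % 2 ≠ 0 by omega]
  rw [if_neg (by omega)] at h8
  rw [gaussValue]
  set z := Complex.exp (Real.pi / 4 * Complex.I)
  rcases hmod with h | h | h | h
  · rw [if_pos (by omega), hval 1 _ hne, one_mul]
    rw [h8, if_pos (by omega), hper _ h, hpow]
    simp
  · rw [if_neg (by omega), hval Complex.I _ hne]
    rw [h8, if_neg (by omega), hper _ h, hpow]
    push_cast
    linear_combination (-Complex.I * z) * hc - z * hI
  · rw [if_pos (by omega), hval 1 _ hne, one_mul]
    rw [h8, if_neg (by omega), hper _ h, hpow]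
    push_cast
    linear_combination (-z * (z ^ 2 + Complex.I)) * hc - z * hI
  · rw [if_neg (by omega), hval Complex.I _ hne]
    rw [h8, if_pos (by omega), hper _ h, hpow]
    push_cast
    linear_combination (Complex.I * z * (z ^ 4 + z ^ 2 * Complex.I + Complex.I ^ 2)) * hc +
      z * (Complex.I ^ 2 - 1) * hI

/-! ### Gauss sums of squarefree odd moduli -/

/-- `exp (2πi k / m)`. -/
noncomputable def unitRoot (m : ℕ) (k : ℤ) : ℂ := Complex.exp (2 * Real.pi * Complex.I * k / m)

theorem unitRoot_eq_stdAddChar (m : ℕ) [NeZero m] (k : ℤ) :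
    unitRoot m k = ZMod.stdAddChar (k : ZMod m) := (ZMod.stdAddChar_coe k).symm

theorem unitRoot_congr {m : ℕ} [NeZero m] {k l : ℤ} (h : k ≡ l [ZMOD m]) :
    unitRoot m k = unitRoot m l := by
  rw [unitRoot_eq_stdAddChar, unitRoot_eq_stdAddChar, (ZMod.intCast_eq_intCast_iff _ _ _).mpr h]

/-- The Bézout relation says 1/(ab) = u/a + v/b. -/
theorem unitRoot_mul {a b : ℕ} (ha : a ≠ 0) (hb : b ≠ 0) {u v : ℤ} (huv : b * u + a * v = 1)
    (k : ℤ) : unitRoot (a * b) k = unitRoot a (k * u) * unitRoot b (k * v) := by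
  have ha' : (a : ℂ) ≠ 0 := by exact_mod_cast ha
  have hb' : (b : ℂ) ≠ 0 := by exact_mod_cast hb
  have h : (b : ℂ) * u + a * v = 1 := by exact_mod_cast huv
  rw [unitRoot, unitRoot, unitRoot, ← Complex.exp_add]
  congr 1
  push_cast
  field_simp
  linear_combination -(k : ℂ) * h

theorem sum_range_mul_of_coprime {a b : ℕ} (hab : a.Coprime b) (ha : a ≠ 0) (hb : b ≠ 0)
    (f g : ℕ → ℂ) :
    ∑ k ∈ Finset.range (a * b), f (k % a) * g (k % b) =
      (∑ k ∈ Finset.range a, f k) * ∑ k ∈ Finset.range b, g k := by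
  rw [Finset.sum_mul_sum, ← Finset.sum_product']
  refine Finset.sum_nbij' (fun k => (k % a, k % b))
    (fun x => (Nat.chineseRemainder hab x.1 x.2 : ℕ)) ?_ ?_ ?_ ?_ (fun _ _ => rfl)
  · intro k _
    simp only [Finset.mem_product, Finset.mem_range]
    exact ⟨Nat.mod_lt _ (Nat.pos_of_ne_zero ha), Nat.mod_lt _ (Nat.pos_of_ne_zero hb)⟩
  · intro x _
    exact Finset.mem_range.mpr (Nat.chineseRemainder_lt_mul hab _ _ ha hb)
  · intro k hk
    have h := Nat.chineseRemainder_modEq_unique hab (Nat.mod_modEq k a).symm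
      (Nat.mod_modEq k b).symm
    exact (h.eq_of_lt_of_lt (Finset.mem_range.mp hk)
      (Nat.chineseRemainder_lt_mul hab _ _ ha hb)).symm
  · rintro ⟨x, y⟩ hx
    simp only [Finset.mem_product, Finset.mem_range] at hx
    have h := (Nat.chineseRemainder hab x y).2
    ext
    · exact Eq.trans h.1 (Nat.mod_eq_of_lt hx.1)
    · exact Eq.trans h.2 (Nat.mod_eq_of_lt hx.2)

/-- The Gauss sum of the Jacobi symbol modulo `m`, twisted by `l`. -/
noncomputable def jacobiGauss (m : ℕ) (l : ℤ) : ℂ :=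
  ∑ k ∈ Finset.range m, (jacobiSym k m : ℂ) * unitRoot m (k * l)

theorem jacobiGauss_prime {p : ℕ} (hp : p.Prime) (hp2 : p ≠ 2) (l : ℤ) :
    jacobiGauss p l = (jacobiSym l p : ℂ) * gaussValue p := by
  have := Fact.mk hp
  have h1 : jacobiGauss p l = gaussSum (quadChar p) (ZMod.stdAddChar.mulShift (l : ZMod p)) := by
    rw [gaussSum, ← sum_range_natCast_zmod, jacobiGauss]
    refine Finset.sum_congr rfl fun k _ => ?_
    rw [← quadChar_intCast, unitRoot_eq_stdAddChar, AddChar.mulShift_apply]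
    push_cast
    rw [mul_comm (l : ZMod p)]
  rw [h1, ← quadChar_intCast]
  by_cases hl : (l : ZMod p) = 0
  · rw [hl, MulChar.map_zero, zero_mul, AddChar.mulShift_zero]
    exact gaussSum_one_right (quadChar_ne_one hp2)
  · have h2 := gaussSum_mulShift (quadChar p) ZMod.stdAddChar (Units.mk0 (l : ZMod p) hl)
    rw [Units.val_mk0, gaussSum_quadChar hp2] at h2
    rw [← h2, ← mul_assoc, quadChar_mul_self hl, one_mul]

/-- The reciprocity sign is exactly the I² = -1 that arises when a and b are both 3 mod 4. -/
theorem gaussValue_mul {a b : ℕ} (ha : Odd a) (hb : Odd b) (hab : a.Coprime b) :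
    (jacobiSym b a : ℂ) * jacobiSym a b * (gaussValue a * gaussValue b) = gaussValue (a * b) := by
  have ha2 := Nat.odd_iff.mp ha
  have hb2 := Nat.odd_iff.mp hb
  have hqr := jacobiSym.quadratic_reciprocity_if ha2 hb2
  have hsq : (jacobiSym b a : ℂ) * jacobiSym b a = 1 := by
    rw [← Int.cast_mul, ← sq, jacobiSym.sq_one (by simpa [Nat.Coprime] using hab.symm), Int.cast_one]
  have hs : ((√(a * b : ℕ) : ℝ) : ℂ) = (√a : ℝ) * (√b : ℝ) := by
    rw [Nat.cast_mul, Real.sqrt_mul (Nat.cast_nonneg a), Complex.ofReal_mul]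
  have hI := Complex.I_sq
  rw [← hqr]
  simp only [gaussValue, hs]
  have hmod : a * b % 4 = (a % 4) * (b % 4) % 4 := Nat.mul_mod _ _ _
  rcases Nat.odd_mod_four_iff.mp ha2 with h1 | h1 <;>
    rcases Nat.odd_mod_four_iff.mp hb2 with h2 | h2 <;>
    simp only [h1, h2] at hmod <;> simp [h1, h2, hmod]
  · linear_combination (√a * √b : ℂ) * hsq
  · linear_combination (Complex.I * √a * √b : ℂ) * hsq
  · linear_combination (Complex.I * √a * √b : ℂ) * hsq
  · linear_combination (√a * √b : ℂ) * hsq - (jacobiSym b a * jacobiSym b a * √a * √b : ℂ) * hI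

/-- The Chinese remainder theorem factors the sum. The twists u, v invert b mod a and a mod b, so
they contribute (b/a) and (a/b), which `gaussValue_mul` absorbs. -/
theorem jacobiGauss_mul {a b : ℕ} (ha : Odd a) (hb : Odd b) (hab : a.Coprime b)
    (iha : ∀ l, jacobiGauss a l = (jacobiSym l a : ℂ) * gaussValue a)
    (ihb : ∀ l, jacobiGauss b l = (jacobiSym l b : ℂ) * gaussValue b) (l : ℤ) :
    jacobiGauss (a * b) l = (jacobiSym l (a * b) : ℂ) * gaussValue (a * b) := by
  have ha0 : a ≠ 0 := by rintro rfl; simp at ha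
  have hb0 : b ≠ 0 := by rintro rfl; simp at hb
  have : NeZero a := ⟨ha0⟩
  have : NeZero b := ⟨hb0⟩
  obtain ⟨u, v, huv⟩ : ∃ u v : ℤ, (b : ℤ) * u + a * v = 1 := by
    have h := Int.isCoprime_iff_gcd_eq_one.mpr (by simpa [Nat.Coprime] using hab.symm :
      Int.gcd (b : ℤ) a = 1)
    obtain ⟨u, v, h⟩ := h
    exact ⟨u, v, by linear_combination h⟩
  have hua : jacobiSym u a = jacobiSym b a := by
    have h1 : jacobiSym (b * u) a = 1 := by
      rw [jacobiSym.mod_left' (a₂ := 1), jacobiSym.one_left]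
      rw [← huv]; simp
    rw [jacobiSym.mul_left] at h1
    rcases Int.isUnit_iff.mp (IsUnit.of_mul_eq_one _ h1) with h | h <;> rw [h] at h1 ⊢ <;> linarith
  have hvb : jacobiSym v b = jacobiSym a b := by
    have h1 : jacobiSym (a * v) b = 1 := by
      rw [jacobiSym.mod_left' (a₂ := 1), jacobiSym.one_left]
      rw [← huv]; simp
    rw [jacobiSym.mul_left] at h1
    rcases Int.isUnit_iff.mp (IsUnit.of_mul_eq_one _ h1) with h | h <;> rw [h] at h1 ⊢ <;> linarith
  have h1 : jacobiGauss (a * b) l = jacobiGauss a (l * u) * jacobiGauss b (l * v) := by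
    rw [jacobiGauss, jacobiGauss, jacobiGauss, ← sum_range_mul_of_coprime hab ha0 hb0]
    refine Finset.sum_congr rfl fun k _ => ?_
    rw [jacobiSym.mul_right, unitRoot_mul ha0 hb0 huv, jacobiSym.mod_left k a,
      jacobiSym.mod_left k b]
    have e1 : unitRoot a (k * l * u) = unitRoot a ((k % a : ℕ) * (l * u)) := by
      apply unitRoot_congr
      rw [mul_assoc]
      exact (Int.ModEq.mul_right _ (by push_cast; exact (Int.mod_modEq _ _).symm))
    have e2 : unitRoot b (k * l * v) = unitRoot b ((k % b : ℕ) * (l * v)) := by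
      apply unitRoot_congr
      rw [mul_assoc]
      exact (Int.ModEq.mul_right _ (by push_cast; exact (Int.mod_modEq _ _).symm))
    rw [e1, e2]
    push_cast
    ring
  rw [h1, iha, ihb, ← gaussValue_mul ha hb hab, jacobiSym.mul_right, jacobiSym.mul_left,
    jacobiSym.mul_left, hua, hvb]
  push_cast
  ring

/-- **Gauss**: the quadratic Gauss sum of an odd squarefree modulus, with its sign. -/
theorem jacobiGauss_eq {m : ℕ} (hm : Odd m) (hsq : Squarefree m) (l : ℤ) :
    jacobiGauss m l = (jacobiSym l m : ℂ) * gaussValue m := by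
  induction m using Nat.recOnPosPrimePosCoprime generalizing l with
  | zero => simp at hm
  | one => simp [jacobiGauss, gaussValue, unitRoot]
  | prime_pow p n hp hn =>
    rw [((Nat.squarefree_pow_iff hp.ne_one hn.ne').mp hsq).2, pow_one]
    refine jacobiGauss_prime hp ?_ l
    rintro rfl
    exact Nat.not_odd_iff_even.mpr (even_two.pow_of_ne_zero hn.ne') hm
  | coprime a b _ _ hab iha ihb =>
    rw [Nat.odd_mul] at hm
    obtain ⟨_, ha, hb⟩ := Nat.squarefree_mul_iff.mp hsq
    exact jacobiGauss_mul hm.1 hm.2 hab (iha hm.1 ha) (ihb hm.2 hb) l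

/-! ### The Jacobi symbol as a cosine sum -/

theorem jacobiSym_sub_left {m k : ℕ} (hm : m % 4 = 1) (hk : k ≤ m) :
    jacobiSym ((m - k : ℕ) : ℤ) m = jacobiSym k m := by
  have h1 : jacobiSym ((m - k : ℕ) : ℤ) m = jacobiSym (-(k : ℤ)) m := by
    apply jacobiSym.mod_left'
    push_cast [hk]
    rw [sub_eq_add_neg, Int.add_emod_left]
  rw [h1, jacobiSym.neg _ (Nat.odd_iff.mpr (by omega)), ZMod.χ₄_nat_one_mod_four hm, one_mul]

theorem sum_range_eq_two_mul_of_symm {t : ℕ} {f : ℕ → ℝ} (h0 : f 0 = 0)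
    (hf : ∀ k ≤ 4 * t + 1, f (4 * t + 1 - k) = f k) :
    ∑ k ∈ Finset.range (4 * t + 1), f k = 2 * ∑ k ∈ Finset.Icc 1 (2 * t), f k := by
  have h1 : ∑ k ∈ Finset.Icc 1 (2 * t), f k = ∑ k ∈ Finset.range (2 * t), f (k + 1) :=
    Finset.sum_nbij' (· - 1) (· + 1) (fun k hk => by simp at hk ⊢; omega)
      (fun k hk => by simp at hk ⊢; omega) (fun k hk => by simp at hk ⊢; omega)
      (fun k hk => by simp) (fun k hk => by
        simp at hk; rw [Nat.sub_add_cancel hk.1])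
  have h2 : ∑ k ∈ Finset.range (2 * t), f (2 * t + k + 1) =
      ∑ k ∈ Finset.range (2 * t), f (k + 1) := by
    rw [← Finset.sum_range_reflect]
    refine Finset.sum_congr rfl fun k hk => ?_
    have hk := Finset.mem_range.mp hk
    rw [← hf (k + 1) (by omega)]
    congr 1
    omega
  rw [Finset.sum_range_succ', h0, add_zero, show 4 * t = 2 * t + 2 * t by ring,
    Finset.sum_range_add, h1, h2]
  ring

/-- The Jacobi symbol as a real trigonometric sum over half of the residues. -/
theorem sqrt_mul_jacobiSym {m t : ℕ} (hm1 : 1 < m) (hsq : Squarefree m) (hm : m = 4 * t + 1)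
    (l : ℤ) : √m * (jacobiSym l m : ℝ) =
      2 * ∑ k ∈ Finset.Icc 1 (2 * t),
        (jacobiSym k m : ℝ) * Real.cos (l * (2 * Real.pi * k / m)) := by
  have hm0 : (m : ℝ) ≠ 0 := by exact_mod_cast (by omega : m ≠ 0)
  have h := jacobiGauss_eq (Nat.odd_iff.mpr (by omega) : Odd m) hsq l
  rw [gaussValue, if_pos (by omega)] at h
  have hre := congrArg Complex.re h
  have hterm : ∀ k : ℕ, ((jacobiSym k m : ℂ) * unitRoot m (k * l)).re =
      (jacobiSym k m : ℝ) * Real.cos (l * (2 * Real.pi * k / m)) := by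
    intro k
    rw [unitRoot, ← Complex.ofReal_intCast, Complex.re_ofReal_mul, ← Complex.exp_ofReal_mul_I_re]
    congr 3
    push_cast
    ring
  rw [jacobiGauss, Complex.re_sum, Finset.sum_congr rfl fun k _ => hterm k,
    ← Complex.ofReal_intCast, ← Complex.ofReal_mul, Complex.ofReal_re] at hre
  rw [mul_comm, ← hre]
  subst hm
  apply sum_range_eq_two_mul_of_symm
  · simp [jacobiSym.zero_left hm1]
  · intro k hk
    rw [jacobiSym_sub_left (by omega) hk]
    congr 1
    rw [Nat.cast_sub hk, show (l : ℝ) * (2 * Real.pi * ((4 * t + 1 : ℕ) - k) / (4 * t + 1 : ℕ)) =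
      l * (2 * Real.pi) - l * (2 * Real.pi * k / (4 * t + 1 : ℕ)) by field_simp,
      Real.cos_int_mul_two_pi_sub]

/-! ### Interchanging the sums over exponents and over odd integers -/

theorem hasSum_swap {F : ℕ → ℕ → ℝ} {A B : ℕ → ℝ} {S : ℝ}
    (hF : Summable fun p : ℕ × ℕ => F p.1 p.2) (hA : ∀ n, HasSum (fun j => F j n) (A n))
    (hB : ∀ j, HasSum (F j) (B j)) (hS : HasSum B S) : HasSum A S := by
  have h1 := hF.hasSum.prod_fiberwise hB
  have h2 := ((Equiv.prodComm ℕ ℕ).hasSum_iff.mpr hF.hasSum).prod_fiberwise hA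
  rwa [← hS.unique h1] at h2

/-- Expanding each term of a series of partial fractions in a geometric series. -/
theorem hasSum_tsum_geometric {c : ℕ → ℝ} {y S : ℝ} (hy : |y| < 1)
    (hc : ∀ j : ℕ, |c j| ≤ |y| / (2 * j + 1 : ℝ) ^ 2)
    (hS : HasSum (fun j : ℕ => c j * ((2 * j + 1 : ℝ) ^ 2 / ((2 * j + 1 : ℝ) ^ 2 - y ^ 2))) S) :
    HasSum (fun n : ℕ => ∑' j : ℕ, c j * (y ^ 2 / (2 * j + 1 : ℝ) ^ 2) ^ n) S := by
  have hq : ∀ j : ℕ, y ^ 2 / (2 * j + 1 : ℝ) ^ 2 < 1 := by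
    intro j
    rw [div_lt_one (by positivity)]
    linarith [odd_sq_sub_sq_pos hy j]
  have hgeo : ∀ j : ℕ, HasSum (fun n : ℕ => (y ^ 2 / (2 * j + 1 : ℝ) ^ 2) ^ n)
      ((2 * j + 1 : ℝ) ^ 2 / ((2 * j + 1 : ℝ) ^ 2 - y ^ 2)) := by
    intro j
    have h := hasSum_geometric_of_lt_one (by positivity) (hq j)
    have hne := (odd_sq_sub_sq_pos hy j).ne'
    have e : (1 - y ^ 2 / (2 * j + 1 : ℝ) ^ 2)⁻¹ =
        (2 * j + 1 : ℝ) ^ 2 / ((2 * j + 1 : ℝ) ^ 2 - y ^ 2) := by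
      rw [one_sub_div (by positivity), inv_div]
    rwa [e] at h
  have hF : Summable fun p : ℕ × ℕ => c p.1 * (y ^ 2 / (2 * p.1 + 1 : ℝ) ^ 2) ^ p.2 := by
    -- Summing the majorant over n first returns |y|/((2j+1)² - y²), already known to be summable.
    have hG : Summable fun p : ℕ × ℕ =>
        |y| / (2 * p.1 + 1 : ℝ) ^ 2 * (y ^ 2 / (2 * p.1 + 1 : ℝ) ^ 2) ^ p.2 := by
      rw [summable_prod_of_nonneg fun p => by positivity]
      refine ⟨fun j => (hgeo j).summable.mul_left (|y| / (2 * j + 1 : ℝ) ^ 2), ?_⟩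
      refine (summable_abs_div_odd_sq_sub_sq hy).congr fun j => ?_
      dsimp only
      rw [tsum_mul_left, (hgeo j).tsum_eq]
      have hl : (2 * j + 1 : ℝ) ≠ 0 := by positivity
      have := (odd_sq_sub_sq_pos hy j).ne'
      field_simp
    refine hG.of_norm_bounded fun p => ?_
    rw [norm_mul, Real.norm_eq_abs, Real.norm_of_nonneg (by positivity)]
    exact mul_le_mul_of_nonneg_right (hc p.1) (by positivity)
  refine hasSum_swap hF (fun n => Summable.hasSum ?_) (fun j => (hgeo j).mul_left (c j)) hS
  exact hF.comp_injective (i := fun j : ℕ => (j, n)) fun a b h => (Prod.ext_iff.mp h).1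

theorem abs_jacobiSym_le_one (a : ℤ) (b : ℕ) : |(jacobiSym a b : ℝ)| ≤ 1 := by
  rcases jacobiSym.trichotomy a b with h | h | h <;> simp [h]

theorem tendsto_dirichletPartial (a : ℤ) {s : ℕ} (hs : 2 ≤ s) :
    Tendsto (dirichletPartial a s) atTop
      (𝓝 (∑' j : ℕ, (jacobiSym (-a) (2 * j + 1) : ℝ) / (2 * j + 1 : ℝ) ^ s)) := by
  have hsum : Summable fun j : ℕ => (jacobiSym (-a) (2 * j + 1) : ℝ) / (2 * j + 1 : ℝ) ^ s := by
    have h1 : Summable fun j : ℕ => 1 / (2 * j + 1 : ℝ) ^ s := by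
      have h0 := (Real.summable_one_div_nat_pow.mpr (show 1 < s by omega)).comp_injective
        (i := fun j : ℕ => 2 * j + 1) fun a b h => by simpa using h
      refine h0.congr fun j => ?_
      simp
    refine h1.of_norm_bounded fun j => ?_
    rw [Real.norm_eq_abs, abs_div, abs_of_nonneg (by positivity : (0 : ℝ) ≤ (2 * j + 1) ^ s)]
    gcongr
    exact abs_jacobiSym_le_one _ _
  refine hsum.hasSum.tendsto_sum_nat.congr fun N => ?_
  simp [dirichletPartial]

theorem dirichletL_eq_tsum (a : ℤ) {s : ℕ} (hs : 2 ≤ s) :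
    dirichletL a s = ∑' j : ℕ, (jacobiSym (-a) (2 * j + 1) : ℝ) / (2 * j + 1 : ℝ) ^ s :=
  (tendsto_dirichletPartial a hs).limUnder_eq

/-! ### Generating series of the L-values -/

/-- The angle `2πk/m`, moved by a right angle into `(0, π)`. -/
noncomputable def angle (m t k : ℕ) : ℝ :=
  if k ≤ t then 2 * Real.pi * k / m + Real.pi / 2 else 2 * Real.pi * k / m - Real.pi / 2

/-- The sign that goes with `angle`. -/
noncomputable def angleSign (t k : ℕ) : ℝ := if k ≤ t then 1 else -1

theorem angle_mem_Ioo {m t k : ℕ} (hm : m = 4 * t + 1) (hk : k ∈ Finset.Icc 1 (2 * t)) :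
    angle m t k ∈ Set.Ioo 0 Real.pi := by
  have hpi := Real.pi_pos
  rw [Finset.mem_Icc] at hk
  have hm0 : (0 : ℝ) < m := by exact_mod_cast (by omega : 0 < m)
  unfold angle
  split_ifs with h
  · have h1 : 4 * (k : ℝ) < m := by exact_mod_cast (by omega : 4 * k < m)
    have h2 : 2 * Real.pi * k / m < Real.pi / 2 := by
      rw [div_lt_div_iff₀ hm0 two_pos]; nlinarith
    have h3 : 0 ≤ 2 * Real.pi * k / m := by positivity
    constructor <;> linarith
  · have h1 : (m : ℝ) < 4 * k := by exact_mod_cast (by omega : m < 4 * k)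
    have h4 : 2 * (k : ℝ) ≤ m := by exact_mod_cast (by omega : 2 * k ≤ m)
    have h2 : Real.pi / 2 < 2 * Real.pi * k / m := by
      rw [div_lt_div_iff₀ two_pos hm0]; nlinarith
    have h3 : 2 * Real.pi * k / m ≤ Real.pi := by
      rw [div_le_iff₀ hm0]; nlinarith
    constructor <;> linarith

/-- (-1)^j is the sine of (2j+1)π/2, whose cosine vanishes, so the addition formula has a single
term. -/
theorem neg_one_pow_mul_cos (m t k j : ℕ) :
    (-1) ^ j * Real.cos ((2 * j + 1) * (2 * Real.pi * k / m)) =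
      angleSign t k * Real.sin ((2 * j + 1) * angle m t k) := by
  have hs := sin_odd_mul_pi_div_two j
  have hc : Real.cos ((2 * j + 1) * (Real.pi / 2)) = 0 :=
    Real.cos_eq_zero_iff.mpr ⟨j, by push_cast; ring⟩
  unfold angle angleSign
  split_ifs with h
  · rw [mul_add, Real.sin_add, hs, hc]; ring
  · rw [mul_sub, Real.sin_sub, hs, hc]; ring

theorem jacobiSym_natCast_odd {m t : ℕ} (hm : m = 4 * t + 1) (j : ℕ) :
    jacobiSym (m : ℤ) (2 * j + 1) = jacobiSym ((2 * j + 1 : ℕ) : ℤ) m :=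
  jacobiSym.quadratic_reciprocity_one_mod_four (by omega) ⟨j, rfl⟩

theorem χ₄_odd (j : ℕ) : ZMod.χ₄ ((2 * j + 1 : ℕ) : ZMod 4) = (-1) ^ j := by
  rw [ZMod.χ₄_eq_neg_one_pow (by omega)]
  congr 1
  omega

theorem jacobiSym_natCast_eq_sum {m t : ℕ} (hm1 : 1 < m) (hsq : Squarefree m)
    (hm : m = 4 * t + 1) (j : ℕ) : (jacobiSym (m : ℤ) (2 * j + 1) : ℝ) =
      2 / √m * ∑ k ∈ Finset.Icc 1 (2 * t),
        (jacobiSym k m : ℝ) * Real.cos ((2 * j + 1) * (2 * Real.pi * k / m)) := by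
  have hs : √(m : ℝ) ≠ 0 := (Real.sqrt_pos.mpr (by exact_mod_cast (by omega : 0 < m))).ne'
  have h := sqrt_mul_jacobiSym hm1 hsq hm ((2 * j + 1 : ℕ) : ℤ)
  push_cast at h
  rw [jacobiSym_natCast_odd hm, div_mul_eq_mul_div, eq_div_iff hs, ← h]
  push_cast
  ring

theorem jacobiSym_neg_eq_sum {m t : ℕ} (hm1 : 1 < m) (hsq : Squarefree m)
    (hm : m = 4 * t + 1) (j : ℕ) : (jacobiSym (-(m : ℤ)) (2 * j + 1) : ℝ) =
      2 / √m * ∑ k ∈ Finset.Icc 1 (2 * t),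
        (jacobiSym k m : ℝ) * (angleSign t k * Real.sin ((2 * j + 1) * angle m t k)) := by
  rw [jacobiSym.neg _ ⟨j, rfl⟩, χ₄_odd]
  push_cast
  rw [jacobiSym_natCast_eq_sum hm1 hsq hm, mul_left_comm, Finset.mul_sum]
  congr 1
  refine Finset.sum_congr rfl fun k _ => ?_
  rw [← neg_one_pow_mul_cos]
  ring

theorem tendsto_dirichletPartial_one {m t : ℕ} (hm1 : 1 < m) (hsq : Squarefree m)
    (hm : m = 4 * t + 1) :
    Tendsto (dirichletPartial (m : ℤ) 1) atTop (𝓝 (2 / √m * ∑ k ∈ Finset.Icc 1 (2 * t),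
      (jacobiSym k m : ℝ) * (angleSign t k * (Real.pi / 4)))) := by
  have hs : √(m : ℝ) ≠ 0 := (Real.sqrt_pos.mpr (by exact_mod_cast (by omega : 0 < m))).ne'
  have h := (tendsto_finsetSum (Finset.Icc 1 (2 * t)) fun k hk =>
    ((tendsto_sum_sin_odd_div (angle_mem_Ioo hm hk)).const_mul (angleSign t k)).const_mul
      (jacobiSym k m : ℝ)).const_mul (2 / √m)
  refine h.congr fun N => ?_
  simp only [dirichletPartial, Finset.mul_sum, pow_one]
  rw [Finset.sum_comm]
  refine Finset.sum_congr rfl fun j _ => ?_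
  rw [jacobiSym_neg_eq_sum hm1 hsq hm, Finset.mul_sum, Finset.sum_div]
  push_cast
  refine Finset.sum_congr rfl fun k _ => ?_
  ring

/-- The geometric expansion needs absolute convergence, so it is applied for n ≥ 1 only, through
l/(l² - y²) - 1/l = y²/(l(l² - y²)). The term n = 0, a finite combination of square waves, cancels
the -1 in the partial fractions. -/
theorem hasSum_even_part {m t : ℕ} (hm1 : 1 < m) (hsq : Squarefree m) (hm : m = 4 * t + 1) {y : ℝ}
    (hy : |y| < 1) :
    HasSum (fun n : ℕ => dirichletL m (2 * n + 1) * y ^ (2 * n))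
      (2 / √m * ∑ k ∈ Finset.Icc 1 (2 * t), (jacobiSym k m : ℝ) * (angleSign t k *
        (Real.pi / 4 * (Real.cos (y * (Real.pi / 2 - angle m t k)) /
          Real.cos (Real.pi * y / 2))))) := by
  have hs : √(m : ℝ) ≠ 0 := (Real.sqrt_pos.mpr (by exact_mod_cast (by omega : 0 < m))).ne'
  have h1 : HasSum (fun j : ℕ => (jacobiSym (-(m : ℤ)) (2 * j + 1) * y ^ 2 / (2 * j + 1 : ℝ) ^ 3) *
      ((2 * j + 1 : ℝ) ^ 2 / ((2 * j + 1 : ℝ) ^ 2 - y ^ 2)))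
      (2 / √m * ∑ k ∈ Finset.Icc 1 (2 * t), (jacobiSym k m : ℝ) * (angleSign t k *
        (Real.pi / 4 * (Real.cos (y * (Real.pi / 2 - angle m t k)) /
          Real.cos (Real.pi * y / 2) - 1)))) := by
    have h := (hasSum_sum fun k hk => ((hasSum_odd_sin hy (Set.Ioo_subset_Icc_self
      (angle_mem_Ioo hm hk))).mul_left (angleSign t k)).mul_left
      (jacobiSym k m : ℝ)).mul_left (2 / √m)
    convert! h using 1
    funext j
    have hl : (2 * j + 1 : ℝ) ≠ 0 := by positivity
    have hl2 := (odd_sq_sub_sq_pos hy j).ne'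
    have e : ∀ a b : ℝ, a * b * y ^ 2 / (2 * j + 1 : ℝ) ^ 3 *
        ((2 * j + 1 : ℝ) ^ 2 / ((2 * j + 1 : ℝ) ^ 2 - y ^ 2)) =
        a * (b * (y ^ 2 / ((2 * j + 1) * ((2 * j + 1 : ℝ) ^ 2 - y ^ 2)))) := by
      intro a b
      field_simp
    rw [jacobiSym_neg_eq_sum hm1 hsq hm, e, Finset.sum_mul]
    congr 1
    refine Finset.sum_congr rfl fun k _ => ?_
    ring
  have h2 := hasSum_tsum_geometric hy (fun j => by
    have hl : (1 : ℝ) ≤ 2 * j + 1 := by have : (0 : ℝ) ≤ j := Nat.cast_nonneg j; linarith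
    rw [abs_div, abs_mul, abs_pow, abs_of_nonneg (by positivity : (0 : ℝ) ≤ (2 * j + 1) ^ 3)]
    have hJ := abs_jacobiSym_le_one (-(m : ℤ)) (2 * j + 1)
    refine div_le_div₀ (abs_nonneg y) ?_ (by positivity) (pow_le_pow_right₀ hl (by norm_num))
    nlinarith [abs_nonneg y, abs_nonneg (jacobiSym (-(m : ℤ)) (2 * j + 1) : ℝ), sq_nonneg |y|]) h1
  have h3 : ∀ n : ℕ, ∑' j : ℕ, (jacobiSym (-(m : ℤ)) (2 * j + 1) * y ^ 2 / (2 * j + 1 : ℝ) ^ 3) *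
      (y ^ 2 / (2 * j + 1 : ℝ) ^ 2) ^ n = dirichletL m (2 * (n + 1) + 1) * y ^ (2 * (n + 1)) := by
    intro n
    rw [dirichletL_eq_tsum _ (by omega), ← tsum_mul_right]
    refine tsum_congr fun j => ?_
    have hl : (2 * j + 1 : ℝ) ≠ 0 := by positivity
    rw [div_pow, ← pow_mul, ← pow_mul]
    field_simp
    ring
  simp_rw [h3] at h2
  rw [← hasSum_nat_add_iff' 1]
  convert! h2 using 1
  rw [Finset.sum_range_one]
  simp only [mul_zero, zero_add, pow_zero, mul_one]
  rw [show dirichletL m 1 = _ from (tendsto_dirichletPartial_one hm1 hsq hm).limUnder_eq, ← mul_sub,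
    ← Finset.sum_sub_distrib]
  congr 1
  refine Finset.sum_congr rfl fun k _ => ?_
  ring

/-- All exponents are at least 2, so nothing has to be split off, and the cosines can be used
without a shift. -/
theorem hasSum_odd_part {m t : ℕ} (hm1 : 1 < m) (hsq : Squarefree m) (hm : m = 4 * t + 1) {y : ℝ}
    (hy : |y| < 1) :
    HasSum (fun n : ℕ => dirichletL (-(m : ℤ)) (2 * (n + 1)) * y ^ (2 * n + 1))
      (2 / √m * ∑ k ∈ Finset.Icc 1 (2 * t), (jacobiSym k m : ℝ) *
        (Real.pi / 4 * (Real.sin (y * (Real.pi / 2 - 2 * Real.pi * k / m)) /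
          Real.cos (Real.pi * y / 2)))) := by
  have hpi := Real.pi_pos
  have hm0 : (0 : ℝ) < m := by exact_mod_cast (by omega : 0 < m)
  have hs : √(m : ℝ) ≠ 0 := (Real.sqrt_pos.mpr hm0).ne'
  have h1 : HasSum (fun j : ℕ => (jacobiSym (m : ℤ) (2 * j + 1) * y / (2 * j + 1 : ℝ) ^ 2) *
      ((2 * j + 1 : ℝ) ^ 2 / ((2 * j + 1 : ℝ) ^ 2 - y ^ 2)))
      (2 / √m * ∑ k ∈ Finset.Icc 1 (2 * t), (jacobiSym k m : ℝ) *
        (Real.pi / 4 * (Real.sin (y * (Real.pi / 2 - 2 * Real.pi * k / m)) /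
          Real.cos (Real.pi * y / 2)))) := by
    have hmem : ∀ k ∈ Finset.Icc 1 (2 * t), 2 * Real.pi * k / m ∈ Set.Icc 0 Real.pi := by
      intro k hk
      rw [Finset.mem_Icc] at hk
      refine ⟨by positivity, ?_⟩
      have h4 : 2 * (k : ℝ) ≤ m := by exact_mod_cast (by omega : 2 * k ≤ m)
      rw [div_le_iff₀ hm0]; nlinarith
    have h := (hasSum_sum fun k hk => (hasSum_odd_cos hy (hmem k hk)).mul_left
      (jacobiSym k m : ℝ)).mul_left (2 / √m)
    convert! h using 1
    funext j
    have hl : (2 * j + 1 : ℝ) ≠ 0 := by positivity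
    have hl2 := (odd_sq_sub_sq_pos hy j).ne'
    rw [jacobiSym_natCast_eq_sum hm1 hsq hm, div_mul_div_cancel₀ (by positivity), mul_assoc, mul_div_assoc, Finset.sum_mul,
      Finset.sum_div]
    congr 1
    refine Finset.sum_congr rfl fun k _ => ?_
    ring
  have h2 := hasSum_tsum_geometric hy (fun j => by
    rw [abs_div, abs_mul, abs_of_nonneg (by positivity : (0 : ℝ) ≤ (2 * j + 1) ^ 2)]
    gcongr
    exact mul_le_of_le_one_left (abs_nonneg y) (abs_jacobiSym_le_one _ _)) h1
  convert! h2 using 1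
  funext n
  rw [dirichletL_eq_tsum _ (by omega), ← tsum_mul_right, neg_neg]
  refine tsum_congr fun j => ?_
  have hl : (2 * j + 1 : ℝ) ≠ 0 := by positivity
  rw [div_pow, ← pow_mul, ← pow_mul]
  field_simp
  ring

/-! ### Assembling the generating function -/

theorem K_of_one_lt {m : ℕ} (hm : 1 < m) : K m = 1 := if_neg (by omega)

theorem s_term_even {m : ℕ} (hm : 1 < m) (n : ℕ) (x : ℝ) :
    s m (2 * n) * x ^ (2 * n) / ((2 * n).factorial : ℝ) = 2 * m / (Real.pi * √m) *
      (dirichletL m (2 * n + 1) * (2 * m * x / Real.pi) ^ (2 * n)) := by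
  have hm0 : (0 : ℝ) < m := by exact_mod_cast (by omega : 0 < m)
  have hs : √(m : ℝ) ≠ 0 := (Real.sqrt_pos.mpr hm0).ne'
  have hf : ((2 * n).factorial : ℝ) ≠ 0 := by exact_mod_cast (2 * n).factorial_ne_zero
  have hpi := Real.pi_ne_zero
  rw [s, if_pos (even_two_mul n), Nat.mul_div_cancel_left _ two_pos, c, K_of_one_lt hm, one_mul,
    ← inv_pow, inv_div, pow_succ, mul_comm (2 * (m : ℝ)) x, mul_div_assoc x, mul_pow x]
  field_simp

theorem s_term_odd {m : ℕ} (hm : 1 < m) (n : ℕ) (x : ℝ) :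
    s m (2 * n + 1) * x ^ (2 * n + 1) / ((2 * n + 1).factorial : ℝ) = 2 * m / (Real.pi * √m) *
      (dirichletL (-(m : ℤ)) (2 * (n + 1)) * (2 * m * x / Real.pi) ^ (2 * n + 1)) := by
  have hm0 : (0 : ℝ) < m := by exact_mod_cast (by omega : 0 < m)
  have hs : √(m : ℝ) ≠ 0 := (Real.sqrt_pos.mpr hm0).ne'
  have hf : ((2 * n + 1).factorial : ℝ) ≠ 0 := by exact_mod_cast (2 * n + 1).factorial_ne_zero
  have hpi := Real.pi_ne_zero
  rw [s, if_neg (Nat.not_even_two_mul_add_one n), show (2 * n + 1 + 1) / 2 = n + 1 by omega, d,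
    K_of_one_lt hm, one_mul, show 2 * (n + 1) - 1 = 2 * n + 1 by omega, ← inv_pow, inv_div,
    show (2 * (m : ℝ) / Real.pi) ^ (2 * (n + 1)) =
      (2 * (m : ℝ) / Real.pi) ^ (2 * n + 1) * (2 * m / Real.pi) from pow_succ _ _,
    mul_comm (2 * (m : ℝ)) x, mul_div_assoc x, mul_pow x]
  field_simp

/-- For k ≤ t the cosine argument is -4kx, with 4k = m - p for p = m - 4k. For k > t it is (2m -
4k)x, with 2m - 4k = m - p for p = 4k - m; there the sine changes sign together with `angleSign`. -/
theorem angle_term {m t k : ℕ} (hm : m = 4 * t + 1) (x : ℝ) :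
    angleSign t k * (Real.cos (2 * m * x / Real.pi * (Real.pi / 2 - angle m t k)) /
        Real.cos (Real.pi * (2 * m * x / Real.pi) / 2)) +
      Real.sin (2 * m * x / Real.pi * (Real.pi / 2 - 2 * Real.pi * k / m)) /
        Real.cos (Real.pi * (2 * m * x / Real.pi) / 2) =
      if k ≤ t then Lam (m : ℤ) ((m : ℤ) - 4 * (k : ℤ)) x
      else -Lam (m : ℤ) (4 * (k : ℤ) - (m : ℤ)) x := by
  have hm0 : (m : ℝ) ≠ 0 := by exact_mod_cast (by omega : m ≠ 0)
  have hpi := Real.pi_ne_zero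
  have e1 : Real.pi * (2 * m * x / Real.pi) / 2 = m * x := by field_simp
  have e2 : 2 * m * x / Real.pi * (Real.pi / 2 - 2 * Real.pi * k / m) = (m - 4 * k) * x := by
    field_simp
    ring
  rw [e1, e2]
  unfold angleSign angle Lam
  push_cast
  split_ifs with h
  · rw [show 2 * m * x / Real.pi * (Real.pi / 2 - (2 * Real.pi * k / m + Real.pi / 2)) =
      -((m - (m - 4 * k)) * x) by field_simp; ring, Real.cos_neg]
    ring
  · rw [show 2 * m * x / Real.pi * (Real.pi / 2 - (2 * Real.pi * k / m - Real.pi / 2)) =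
      (m - (4 * k - m)) * x by field_simp; ring,
      show ((m : ℝ) - 4 * k) * x = -((4 * k - m) * x) by ring, Real.sin_neg]
    ring

theorem hasSum_sGen {m t : ℕ} (hm1 : 1 < m) (hsq : Squarefree m) (hm : m = 4 * t + 1) {x : ℝ}
    (hx : |x| < Real.pi / (2 * (m : ℝ))) :
    HasSum (fun n : ℕ => s m n * x ^ n / (n.factorial : ℝ))
      (∑ k ∈ Finset.Icc 1 t, (jacobiSym (k : ℤ) m : ℝ) * Lam (m : ℤ) ((m : ℤ) - 4 * (k : ℤ)) x -
        ∑ k ∈ Finset.Icc (t + 1) (2 * t),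
          (jacobiSym (k : ℤ) m : ℝ) * Lam (m : ℤ) (4 * (k : ℤ) - (m : ℤ)) x) := by
  have hm0 : (0 : ℝ) < m := by exact_mod_cast (by omega : 0 < m)
  have hs : √(m : ℝ) ≠ 0 := (Real.sqrt_pos.mpr hm0).ne'
  have hpi := Real.pi_pos
  have hy : |2 * m * x / Real.pi| < 1 := by
    rw [abs_div, abs_mul, abs_of_pos hpi, abs_of_pos (by positivity : 0 < 2 * (m : ℝ)),
      div_lt_one hpi, mul_comm]
    exact (lt_div_iff₀ (by positivity)).mp hx
  have he := (hasSum_even_part hm1 hsq hm hy).mul_left (2 * m / (Real.pi * √m))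
  have ho := (hasSum_odd_part hm1 hsq hm hy).mul_left (2 * m / (Real.pi * √m))
  simp_rw [← s_term_even hm1] at he
  simp_rw [← s_term_odd hm1] at ho
  have h := HasSum.even_add_odd (f := fun n : ℕ => s m n * x ^ n / (n.factorial : ℝ)) he ho
  convert! h using 1
  -- The normalisation of s_m, the Gauss sum factor 2/√m and the π/4 of the partial fractions
  -- cancel.
  have hcoef : 2 * m / (Real.pi * √m) * (2 / √m) * (Real.pi / 4) = 1 := by
    have : √(m : ℝ) * √m = m := Real.mul_self_sqrt hm0.le
    field_simp
    nlinarith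
  have hsplit : ∀ f : ℕ → ℝ, ∑ k ∈ Finset.Icc 1 (2 * t), f k =
      ∑ k ∈ Finset.Icc 1 t, f k + ∑ k ∈ Finset.Icc (t + 1) (2 * t), f k := by
    intro f
    rw [← Finset.sum_union]
    · congr 1
      ext k
      simp only [Finset.mem_union, Finset.mem_Icc]
      omega
    · rw [Finset.disjoint_left]
      intro k hk hk'
      simp only [Finset.mem_Icc] at hk hk'
      omega
  have hterm : ∑ k ∈ Finset.Icc 1 (2 * t), (jacobiSym (k : ℤ) m : ℝ) *
      (if k ≤ t then Lam (m : ℤ) ((m : ℤ) - 4 * (k : ℤ)) x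
        else -Lam (m : ℤ) (4 * (k : ℤ) - (m : ℤ)) x) =
      ∑ k ∈ Finset.Icc 1 t, (jacobiSym (k : ℤ) m : ℝ) * Lam (m : ℤ) ((m : ℤ) - 4 * (k : ℤ)) x -
        ∑ k ∈ Finset.Icc (t + 1) (2 * t),
          (jacobiSym (k : ℤ) m : ℝ) * Lam (m : ℤ) (4 * (k : ℤ) - (m : ℤ)) x := by
    rw [hsplit, sub_eq_add_neg, ← Finset.sum_neg_distrib]
    congr 1
    · refine Finset.sum_congr rfl fun k hk => ?_
      rw [if_pos (Finset.mem_Icc.mp hk).2]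
    · refine Finset.sum_congr rfl fun k hk => ?_
      have := (Finset.mem_Icc.mp hk).1
      rw [if_neg (by omega), mul_neg]
  rw [← hterm, ← mul_assoc, ← mul_assoc, Finset.mul_sum, Finset.mul_sum, ← Finset.sum_add_distrib]
  refine Finset.sum_congr rfl fun k _ => ?_
  rw [← angle_term hm x]
  generalize Real.cos _ / _ = u
  generalize Real.sin _ / _ = v
  linear_combination (-(jacobiSym k m : ℝ) * (angleSign t k * u + v)) * hcoef

end GenEuler

theorem theorem2p2 (m t : ℕ) (hm1 : 1 < m) (hsq : Squarefree m) (hm : m = 4 * t + 1) :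
    -- the Dirichlet series that define the numbers `s_{m,n}` converge
    (∀ n : ℕ, Tendsto (GenEuler.dirichletPartial (m : ℤ) (2 * n + 1)) atTop
      (𝓝 (GenEuler.dirichletL (m : ℤ) (2 * n + 1)))) ∧
    (∀ n : ℕ, 1 ≤ n → Tendsto (GenEuler.dirichletPartial (-(m : ℤ)) (2 * n)) atTop
      (𝓝 (GenEuler.dirichletL (-(m : ℤ)) (2 * n)))) ∧
    -- the generating function converges for `|x| < π / (2m)` and has the claimed value there
    (∀ x : ℝ, |x| < Real.pi / (2 * (m : ℝ)) →
      Summable (fun n : ℕ => GenEuler.s m n * x ^ n / (n.factorial : ℝ)) ∧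
      GenEuler.sGen m x =
        ∑ k ∈ Finset.Icc 1 t,
          (jacobiSym (k : ℤ) m : ℝ) * GenEuler.Lam (m : ℤ) ((m : ℤ) - 4 * (k : ℤ)) x -
        ∑ k ∈ Finset.Icc (t + 1) (2 * t),
          (jacobiSym (k : ℤ) m : ℝ) * GenEuler.Lam (m : ℤ) (4 * (k : ℤ) - (m : ℤ)) x) := by
  refine ⟨fun n => ?_, fun n hn => ?_, fun x hx => ?_⟩
  · rcases Nat.eq_zero_or_pos n with rfl | hn
    -- Exponent 1 is not covered by absolute convergence; the square wave supplies the limit.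
    · exact tendsto_nhds_limUnder ⟨_, GenEuler.tendsto_dirichletPartial_one hm1 hsq hm⟩
    · exact tendsto_nhds_limUnder ⟨_, GenEuler.tendsto_dirichletPartial _ (by omega)⟩
  · exact tendsto_nhds_limUnder ⟨_, GenEuler.tendsto_dirichletPartial _ (by omega)⟩
  · have h := GenEuler.hasSum_sGen hm1 hsq hm hx
    exact ⟨h.summable, h.tsum_eq⟩
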